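/- All graphs are finite, simple and undirected (not necessarily connected). An induced cycle of length $m\ge 3$ in $G$ is an induced subgraph of $G$ that is a cycle on $m$ vertices. For a natural number $k$, a graph is called strictly chordality-$k$ (an $SC_k$ graph) if it has no induced cycle, or if every induced cycle of it has length exactly $k$. A set of vertices is independent if no two of its vertices are adjacent, and it is a vertex cover if every edge has at least one end in it. Running times are measured on a deterministic random access machine with registers and arrays of natural numbers, whose instructions (loading a constant, copying, addition, truncated subtraction, indirect array access, and testing whether a register is nonzero) take one step each. An input graph on the vertices $0,\dots,n-1$ is given by $n$ and its adjacency matrix, and a vertex set is output as its indicator vector. **Theorem.** 1. There are a program and a polynomial $p$ such that, for every $k\ge 5$ and every $SC_k$ graph $G$ with $n$ vertices, the program halts on input $G$ after at most $p(n)$ steps and outputs an independent set of $G$ of maximum cardinality. 2. There are a program and a polynomial $q$ such that, for every $k\ge 5$ and every $SC_k$ graph $G$ with $n$ vertices, the program halts on input $G$ after at most $q(n)$ steps and outputs a vertex cover of $G$ of minimum cardinality. -/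

import Mathlib

/-! ## Strictly chordality-`k` graphs -/

/-- `G` has an induced cycle on exactly `m` vertices (a cycle has at least three vertices). -/
def HasInducedCycle {V : Type*} (G : SimpleGraph V) (m : ℕ) : Prop :=
  3 ≤ m ∧ (SimpleGraph.cycleGraph m).IsIndContained G

/-- `G` is strictly chordality-`k`: it is cycle-free (it has no induced cycle), or every induced
cycle of `G` has exactly `k` vertices. -/
def IsStrictlyChordality {V : Type*} (k : ℕ) (G : SimpleGraph V) : Prop :=
  (∀ m, ¬ HasInducedCycle G m) ∨ ∀ m, HasInducedCycle G m → m = k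

/-- `S` is a vertex cover of `G` of minimum cardinality. -/
def IsMinimumVertexCover {V : Type*} (G : SimpleGraph V) (S : Finset V) : Prop :=
  G.IsVertexCover (S : Set V) ∧
    ∀ T : Finset V, G.IsVertexCover (T : Set V) → S.card ≤ T.card

/-! ## Random access machines with unit cost

The machine has registers holding natural numbers and zero-based arrays of natural numbers of
unbounded length. The only arithmetic is addition and truncated subtraction, so that unit cost is
polynomially equivalent to Turing machine time. A program is a finite object and can therefore
mention only finitely many registers and arrays, through constants. -/

namespace RAM

/-- A memory state: `reg x` is the content of register `x`, and `arr a i` is the entry with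
index `i` of array `a`. -/
structure State where
  reg : ℕ → ℕ
  arr : ℕ → ℕ → ℕ

/-- The elementary instructions. -/
inductive Instr where
  /-- `x := c` -/
  | const (x c : ℕ)
  /-- `x := y` -/
  | move (x y : ℕ)
  /-- `x := y + z` -/
  | add (x y z : ℕ)
  /-- `x := y - z`, which is `0` when `y ≤ z` -/
  | sub (x y z : ℕ)
  /-- `x := a[y]` -/
  | load (x a y : ℕ)
  /-- `a[x] := y` -/
  | store (a x y : ℕ)

/-- Write the value `v` into register `x`. -/
def State.setReg (s : State) (x v : ℕ) : State :=
  { s with reg := Function.update s.reg x v }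

/-- Write the value `v` into entry `i` of array `a`. -/
def State.setArr (s : State) (a i v : ℕ) : State :=
  { s with arr := Function.update s.arr a (Function.update (s.arr a) i v) }

/-- The effect of an elementary instruction on the memory. -/
def Instr.apply (s : State) : Instr → State
  | .const x c => s.setReg x c
  | .move x y => s.setReg x (s.reg y)
  | .add x y z => s.setReg x (s.reg y + s.reg z)
  | .sub x y z => s.setReg x (s.reg y - s.reg z)
  | .load x a y => s.setReg x (s.arr a (s.reg y))
  | .store a x y => s.setArr a (s.reg x) (s.reg y)

/-- Structured programs: instructions, sequencing, branching on whether a register is nonzero,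
and looping while a register is nonzero. -/
inductive Prog where
  | instr (i : Instr)
  | seq (P Q : Prog)
  | ite (x : ℕ) (P Q : Prog)
  | loop (x : ℕ) (P : Prog)

/-- `Exec P s t s'`: program `P`, started in the state `s`, halts in the state `s'` after
exactly `t` steps. Each elementary instruction and each test of a register is one step. -/
inductive Exec : Prog → State → ℕ → State → Prop
  | instr (i : Instr) (s : State) : Exec (.instr i) s 1 (i.apply s)
  | seq {P Q : Prog} {s s' s'' : State} {t t' : ℕ} :
      Exec P s t s' → Exec Q s' t' s'' → Exec (.seq P Q) s (t + t') s''
  | iteTrue {x : ℕ} {P Q : Prog} {s s' : State} {t : ℕ} :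
      s.reg x ≠ 0 → Exec P s t s' → Exec (.ite x P Q) s (1 + t) s'
  | iteFalse {x : ℕ} {P Q : Prog} {s s' : State} {t : ℕ} :
      s.reg x = 0 → Exec Q s t s' → Exec (.ite x P Q) s (1 + t) s'
  | loopStop {x : ℕ} {P : Prog} {s : State} :
      s.reg x = 0 → Exec (.loop x P) s 1 s
  | loopStep {x : ℕ} {P : Prog} {s s' s'' : State} {t t' : ℕ} :
      s.reg x ≠ 0 → Exec P s t s' → Exec (.loop x P) s' t' s'' →
      Exec (.loop x P) s (1 + t + t') s''

/-- Programs are deterministic: the running time and the final state are unique. -/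
theorem Exec.deterministic {P : Prog} {s s₁ s₂ : State} {t₁ t₂ : ℕ}
    (h₁ : Exec P s t₁ s₁) (h₂ : Exec P s t₂ s₂) : t₁ = t₂ ∧ s₁ = s₂ := by
  induction h₁ generalizing t₂ s₂ with
  | instr i s => cases h₂; exact ⟨rfl, rfl⟩
  | seq _ _ ih ih' =>
    cases h₂ with
    | seq hP hQ =>
      obtain ⟨rfl, rfl⟩ := ih hP
      obtain ⟨rfl, rfl⟩ := ih' hQ
      exact ⟨rfl, rfl⟩
  | iteTrue hx _ ih =>
    cases h₂ with
    | iteTrue _ hP => obtain ⟨rfl, rfl⟩ := ih hP; exact ⟨rfl, rfl⟩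
    | iteFalse hx' _ => exact absurd hx' hx
  | iteFalse hx _ ih =>
    cases h₂ with
    | iteTrue hx' _ => exact absurd hx hx'
    | iteFalse _ hP => obtain ⟨rfl, rfl⟩ := ih hP; exact ⟨rfl, rfl⟩
  | loopStop hx =>
    cases h₂ with
    | loopStop _ => exact ⟨rfl, rfl⟩
    | loopStep hx' _ _ => exact absurd hx hx'
  | loopStep hx _ _ ih ih' =>
    cases h₂ with
    | loopStop hx' => exact absurd hx' hx
    | loopStep _ hP hQ =>
      obtain ⟨rfl, rfl⟩ := ih hP
      obtain ⟨rfl, rfl⟩ := ih' hQ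
      exact ⟨rfl, rfl⟩

open Classical in
/-- The initial state for an input graph on the vertices `0, …, n - 1`: register `0` holds `n`,
array `0` holds the adjacency matrix row by row, and everything else is `0`. -/
noncomputable def inputState {n : ℕ} (G : SimpleGraph (Fin n)) : State where
  reg x := if x = 0 then n else 0
  arr a m := if a = 0 ∧ ∃ i j : Fin n, m = (i : ℕ) * n + (j : ℕ) ∧ G.Adj i j then 1 else 0

/-- The first `n` entries of array `1` are the indicator vector of the vertex set `S`. -/
def Outputs {n : ℕ} (s : State) (S : Finset (Fin n)) : Prop :=
  ∀ i : Fin n, s.arr 1 (i : ℕ) = if i ∈ S then 1 else 0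

/-- On the graphs of the class `C`, a vertex set with the property `R` can be computed in
polynomial time: one program and one polynomial `p` are such that on every graph of `C` with `n`
vertices the program halts within `p(n)` steps and outputs a vertex set with the property `R`. -/
def PolyTimeSolvable (C : ∀ n : ℕ, SimpleGraph (Fin n) → Prop)
    (R : ∀ n : ℕ, SimpleGraph (Fin n) → Finset (Fin n) → Prop) : Prop :=
  ∃ (P : Prog) (p : Polynomial ℕ), ∀ (n : ℕ) (G : SimpleGraph (Fin n)), C n G →
    ∃ (t : ℕ) (s : State) (S : Finset (Fin n)),
      Exec P (inputState G) t s ∧ t ≤ p.eval n ∧ Outputs s S ∧ R n G S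

end RAM

/-!
The program finds a maximum independent set by deleting vertices of degree at most two. Let `v` be
a vertex whose neighbours all lie in `{u, w}`. If these neighbours form a clique, then some maximum
independent set contains `v`, and `v` is selected and deleted with its neighbours. If `u` and `w`
are distinct and not adjacent, then `v`, `u`, `w` are contracted to a single vertex; a maximum
independent set of the smaller graph is lifted by replacing the new vertex by `u` and `w` if it is
selected, and by adding `v` otherwise (`IsMaxIndepIn.insert_of_adj`, `IsMaxIndepIn.unfold`). The
reductions are kept on a stack and are undone in reverse order at the end. A minimum vertex cover is
the complement of a maximum independent set.

This succeeds if a vertex of degree at most two can always be found. Strict chordality is not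
preserved by the contractions, but the absence of a minor isomorphic to the complete graph `K₄` is
(`HasK4Model.of_mergeInto`), and it guarantees such a vertex (`exists_degree_le_two`, by an extremal
argument with a longest path).

It remains to see that a graph whose induced cycles all have the same length `k ≥ 5` has no `K₄`
minor (`not_hasK4Model`). Such a minor yields a cycle and a connected set `D` outside the cycle with
at least three neighbours on it. If the cycle is as short as possible, then it is induced, because a
chord leads to a shorter cycle of the same kind. As there are no induced triangles and no induced
cycles of length four, every vertex of `D` has at most one neighbour on the cycle, so `D` can be
shrunk until exactly three vertices of the cycle have neighbours in it. They divide the cycle into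
arcs of lengths `a`, `b`, `c` with `a + b + c = k`. An induced path through `D` between two of the
three vertices closes an induced cycle with the arc between them, and also with the complementary
arc if the path stays away from the third vertex. In the latter case the arc has length `1` or
`k / 2`, and for `k ≥ 5` the three arcs cannot all have such lengths. A path that touches the third
vertex splits into two paths that do not touch the remaining one, and again the resulting equations
have no solution (`IsTripleContact.not_adj_third`, `not_isTripleContact`).

The program is written in a language with loops of a fixed number `n` of iterations, which gives its
semantics as a function on memory states and a polynomial bound for its running time
(`Code.exec_compile`); loops are treated with invariants (`Code.eval_each_induction`).
-/

/-! ### Connected sets and induced paths -/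

namespace SimpleGraph

variable {V : Type*} {G H : SimpleGraph V}

/-- A nonempty vertex set `S` is connected in `G`, expressed by cuts: every proper nonempty part
of `S` sends an edge to the rest of `S`. -/
def IsConn (G : SimpleGraph V) (S : Set V) : Prop :=
  S.Nonempty ∧ ∀ T ⊆ S, T.Nonempty → T ≠ S → ∃ a ∈ T, ∃ b ∈ S \ T, G.Adj a b

/-- `f 0, …, f r` are the vertices of an induced path. -/
def IsIndPath (G : SimpleGraph V) (r : ℕ) (f : ℕ → V) : Prop :=
  ∀ s t, s < t → t ≤ r → f s ≠ f t ∧ (G.Adj (f s) (f t) ↔ t = s + 1)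

theorem isConn_singleton (G : SimpleGraph V) (v : V) : IsConn G {v} := by
  refine ⟨⟨v, rfl⟩, fun T hT hne hTS => absurd ?_ hTS⟩
  obtain ⟨x, hx⟩ := hne
  refine Set.Subset.antisymm hT ?_
  rintro y rfl
  exact (hT hx : x = y) ▸ hx

theorem IsConn.union {S T : Set V} (hS : IsConn G S) (hT : IsConn G T)
    (h : ∃ a ∈ S, ∃ b ∈ T, G.Adj a b) : IsConn G (S ∪ T) := by
  refine ⟨hS.1.mono Set.subset_union_left, fun R hR hne hRn => ?_⟩
  by_contra! hcut
  -- an uncut set that meets `S` (or `T`) contains it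
  have key : ∀ Q : Set V, Q ⊆ S ∪ T → IsConn G Q → (R ∩ Q).Nonempty → Q ⊆ R := by
    intro Q hQ hconn hne'
    by_contra hn
    obtain ⟨a, ha, b, hb, hab⟩ := hconn.2 (R ∩ Q) Set.inter_subset_right hne'
      (fun h => hn (h ▸ Set.inter_subset_left))
    exact hcut a ha.1 b ⟨hQ hb.1, fun h => hb.2 ⟨h, hb.1⟩⟩ hab
  obtain ⟨a, ha, b, hb, hab⟩ := h
  have hSR : S ⊆ R ↔ T ⊆ R := by
    constructor
    · intro hs
      refine key T Set.subset_union_right hT ⟨b, ?_, hb⟩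
      by_contra hbR
      exact hcut a (hs ha) b ⟨Or.inr hb, hbR⟩ hab
    · intro ht
      refine key S Set.subset_union_left hS ⟨a, ?_, ha⟩
      by_contra haR
      exact hcut b (ht hb) a ⟨Or.inl ha, haR⟩ hab.symm
  obtain ⟨x, hx⟩ := hne
  have : S ⊆ R ∧ T ⊆ R := by
    rcases hR hx with h | h
    · have := key S Set.subset_union_left hS ⟨x, hx, h⟩
      exact ⟨this, hSR.1 this⟩
    · have := key T Set.subset_union_right hT ⟨x, hx, h⟩
      exact ⟨hSR.2 this, this⟩
  exact hRn (Set.Subset.antisymm hR (Set.union_subset this.1 this.2))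

/-- The vertices of a walk, given as a sequence, form a connected set. -/
theorem isConn_image_Icc {f : ℕ → V} {a b : ℕ} (hab : a ≤ b)
    (h : ∀ t, a ≤ t → t < b → G.Adj (f t) (f (t + 1))) : IsConn G (f '' Set.Icc a b) := by
  induction b, hab using Nat.le_induction with
  | base => simpa using isConn_singleton G (f a)
  | succ b hab ih =>
    have hI : f '' Set.Icc a (b + 1) = f '' Set.Icc a b ∪ {f (b + 1)} := by
      rw [← Set.image_singleton, ← Set.image_union]
      congr 1
      ext t
      simp only [Set.mem_Icc, Set.mem_union, Set.mem_singleton_iff]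
      omega
    rw [hI]
    exact (ih fun t h1 h2 => h t h1 (by omega)).union (isConn_singleton G _)
      ⟨f b, ⟨b, ⟨hab, le_rfl⟩, rfl⟩, _, rfl, h b hab (by omega)⟩

/-- A shortest path between two parts `X` and `Y` of a connected set: it is induced, and it meets
`X` only in its first vertex and `Y` only in its last one. -/
theorem IsConn.exists_indPath {A : Set V} (hA : IsConn G A) (X Y : V → Prop)
    (hX : ∃ a ∈ A, X a) (hY : ∃ a ∈ A, Y a) :
    ∃ (r : ℕ) (f : ℕ → V), IsIndPath G r f ∧ (∀ t ≤ r, f t ∈ A) ∧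
      (∀ t ≤ r, X (f t) ↔ t = 0) ∧ (∀ t ≤ r, Y (f t) ↔ t = r) := by
  classical
  let Q : ℕ → (V → Prop) → Prop := fun r Z => ∃ f : ℕ → V, (∀ t ≤ r, f t ∈ A) ∧
    (∀ t < r, G.Adj (f t) (f (t + 1))) ∧ X (f 0) ∧ Z (f r)
  have hex : ∃ r, Q r Y := by
    let T : Set V := {b | ∃ r, Q r (· = b)}
    have hTA : T ⊆ A := by
      rintro b ⟨r, f, hf, -, -, rfl⟩
      exact hf r le_rfl
    have hT : T = A := by
      by_contra hne
      obtain ⟨x, hxA, hx⟩ := hX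
      obtain ⟨a, ⟨r, f, hf, hadj, h0, hr⟩, b, hb, hab⟩ := hA.2 T hTA
        ⟨x, 0, fun _ => x, fun _ _ => hxA, by simp, hx, rfl⟩ hne
      refine hb.2 ⟨r + 1, fun t => if t ≤ r then f t else b, ?_, ?_, by simpa using h0, by simp⟩
      · intro t ht
        by_cases h : t ≤ r
        · simpa [h] using hf t h
        · simpa [h] using hb.1
      · intro t ht
        rcases Nat.lt_succ_iff_lt_or_eq.1 ht with h | h
        · simpa [h.le, Nat.succ_le_of_lt h] using hadj t h
        · subst h
          simpa [hr] using hab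
    obtain ⟨y, hyA, hy⟩ := hY
    obtain ⟨r, f, h1, h2, h3, h4⟩ := hT.symm ▸ hyA
    exact ⟨r, f, h1, h2, h3, by rw [h4]; exact hy⟩
  have hmin := fun m => @Nat.find_min _ _ hex m
  obtain ⟨f, hf, hadj, h0, hr⟩ := Nat.find_spec hex
  set r := Nat.find hex
  have hXf : ∀ t ≤ r, X (f t) → t = 0 := by
    intro t ht hXt
    by_contra hne
    refine hmin (r - t) (by omega) ⟨fun s => f (s + t), fun s hs => hf _ (by omega), ?_,
      by simpa using hXt, by simpa [Nat.sub_add_cancel ht] using hr⟩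
    intro s hs
    have := hadj (s + t) (by omega)
    rwa [Nat.add_right_comm] at this
  have hYf : ∀ t ≤ r, Y (f t) → t = r := by
    intro t ht hYt
    by_contra hne
    exact hmin t (by omega) ⟨f, fun s hs => hf s (by omega), fun s hs => hadj s (by omega),
      h0, hYt⟩
  have hchord : ∀ s t, s + 1 < t → t ≤ r → ¬ G.Adj (f s) (f t) := by
    intro s t hst ht hadj'
    refine hmin (r - (t - s - 1)) (by omega)
      ⟨fun u => if u ≤ s then f u else f (u + (t - s - 1)), ?_, ?_, by simpa using h0, ?_⟩
    · intro u hu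
      dsimp only
      split_ifs
      · exact hf _ (by omega)
      · exact hf _ (by omega)
    · intro u hu
      dsimp only
      rcases lt_trichotomy u s with h | h | h
      · rw [if_pos (by omega), if_pos (by omega)]
        exact hadj u (by omega)
      · subst h
        rw [if_pos le_rfl, if_neg (by omega), show u + 1 + (t - u - 1) = t by omega]
        exact hadj'
      · rw [if_neg (by omega), if_neg (by omega),
          show u + 1 + (t - s - 1) = u + (t - s - 1) + 1 by omega]
        exact hadj _ (by omega)
    · dsimp only
      rw [if_neg (by omega), show r - (t - s - 1) + (t - s - 1) = r by omega]
      exact hr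
  refine ⟨r, f, fun s t hst ht => ⟨fun heq => ?_, fun h => ?_, ?_⟩, hf,
    fun t ht => ⟨hXf t ht, by rintro rfl; exact h0⟩, fun t ht => ⟨hYf t ht, by rintro rfl; exact hr⟩⟩
  · rcases ht.lt_or_eq with h | h
    · exact hchord s (t + 1) (by omega) (by omega) (heq ▸ hadj t h)
    · subst h
      have := hYf s hst.le (heq ▸ hr)
      omega
  · by_contra hne
    exact hchord s t (by omega) ht h
  · rintro rfl
    exact hadj s (by omega)

theorem IsIndPath.adj {r : ℕ} {f : ℕ → V} (h : IsIndPath G r f) {t : ℕ} (ht : t < r) :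
    G.Adj (f t) (f (t + 1)) :=
  (h t (t + 1) (by omega) (by omega)).2.2 rfl

theorem IsIndPath.reverse {r : ℕ} {f : ℕ → V} (h : IsIndPath G r f) :
    IsIndPath G r (fun t => f (r - t)) := by
  intro s t hst ht
  have := h (r - t) (r - s) (by omega) (by omega)
  refine ⟨this.1.symm, ?_⟩
  rw [G.adj_comm, this.2]
  omega

/-! ### Induced cycles as sequences -/

/-- A chordless closed sequence `f 0, …, f m` is an induced cycle on `m + 1` vertices. -/
theorem hasInducedCycle_of_seq {m : ℕ} (hm : 2 ≤ m) {f : ℕ → V}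
    (h : ∀ s t, s < t → t ≤ m →
      f s ≠ f t ∧ (G.Adj (f s) (f t) ↔ t = s + 1 ∨ (s = 0 ∧ t = m))) :
    HasInducedCycle G (m + 1) := by
  refine ⟨by omega, ⟨⟨⟨fun i => f i, ?_⟩, ?_⟩⟩⟩
  · intro i j hij
    by_contra hne
    rcases lt_or_gt_of_ne (Fin.val_ne_of_ne hne) with hlt | hlt
    · exact (h i j hlt (by omega)).1 hij
    · exact (h j i hlt (by omega)).1 hij.symm
  · intro i j
    obtain ⟨m, rfl⟩ : ∃ m', m = m' + 1 := ⟨m - 1, by omega⟩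
    have key : ∀ i j : Fin (m + 1 + 1), i < j →
        (G.Adj (f i) (f j) ↔ (cycleGraph (m + 1 + 1)).Adj i j) := by
      intro i j hij
      rw [(h i j hij (by omega)).2, cycleGraph_adj]
      have hij' : (i : ℕ) < j := hij
      have h1 : (i - j = 1) ↔ ((i : ℕ) = 0 ∧ (j : ℕ) = m + 1) := by
        rw [Fin.ext_iff, Fin.sub_def]
        have hi := i.2
        have hj := j.2
        have : m + 1 + 1 - (j : ℕ) + i < m + 1 + 1 := by omega
        simp only [Nat.mod_eq_of_lt this]
        rw [show ((1 : Fin (m + 1 + 1)) : ℕ) = 1 from rfl]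
        omega
      have h2 : (j - i = 1) ↔ ((j : ℕ) = i + 1) := by
        rw [Fin.ext_iff, Fin.sub_val_of_le hij.le, show ((1 : Fin (m + 1 + 1)) : ℕ) = 1 from rfl]
        omega
      rw [h1, h2]
      tauto
    rcases lt_trichotomy i j with hlt | rfl | hlt
    · exact key i j hlt
    · simp
    · have := key j i hlt
      rw [G.adj_comm, (cycleGraph _).adj_comm] at this
      exact this

/-- The periodic sequence `c` runs around an induced cycle on `k` vertices. -/
structure IsIndCycle (G : SimpleGraph V) (k : ℕ) (c : ℕ → V) : Prop where
  three_le : 3 ≤ k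
  periodic : ∀ t, c (t + k) = c t
  ne : ∀ s t, s < t → t < s + k → c s ≠ c t
  adj_iff : ∀ s t, s < t → t < s + k → (G.Adj (c s) (c t) ↔ t = s + 1 ∨ t + 1 = s + k)

theorem isIndCycle_of_seq {m : ℕ} (hm : 2 ≤ m) {f : ℕ → V}
    (h : ∀ s t, s < t → t ≤ m →
      f s ≠ f t ∧ (G.Adj (f s) (f t) ↔ t = s + 1 ∨ (s = 0 ∧ t = m))) :
    IsIndCycle G (m + 1) (fun t => f (t % (m + 1))) := by
  have key : ∀ s t, s < t → t < s + (m + 1) →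
      f (s % (m + 1)) ≠ f (t % (m + 1)) ∧
        (G.Adj (f (s % (m + 1))) (f (t % (m + 1))) ↔ t = s + 1 ∨ t + 1 = s + (m + 1)) := by
    intro s t hst ht
    have hs := Nat.div_add_mod s (m + 1)
    have ht' := Nat.div_add_mod t (m + 1)
    have hsl := Nat.mod_lt s (show m + 1 > 0 by omega)
    have htl := Nat.mod_lt t (show m + 1 > 0 by omega)
    generalize s % (m + 1) = s' at *
    generalize t % (m + 1) = t' at *
    generalize s / (m + 1) = q at *
    generalize t / (m + 1) = q' at *
    have hq : q' = q ∨ q' = q + 1 := by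
      have h1 : q ≤ q' := by
        by_contra hlt
        have : (m + 1) * (q' + 1) ≤ (m + 1) * q := Nat.mul_le_mul_left _ (by omega)
        rw [Nat.mul_add] at this
        omega
      have h2 : q' < q + 2 := by
        by_contra hlt
        have : (m + 1) * (q + 2) ≤ (m + 1) * q' := Nat.mul_le_mul_left _ (by omega)
        rw [Nat.mul_add] at this
        omega
      omega
    rcases hq with rfl | rfl
    · have := h s' t' (by omega) (by omega)
      refine ⟨this.1, ?_⟩
      rw [this.2]
      omega
    · rw [Nat.mul_add] at ht'
      have := h t' s' (by omega) (by omega)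
      refine ⟨this.1.symm, ?_⟩
      rw [G.adj_comm, this.2]
      omega
  exact ⟨by omega, fun t => by simp, fun s t h1 h2 => (key s t h1 h2).1,
    fun s t h1 h2 => (key s t h1 h2).2⟩

end SimpleGraph

/-! ### Attachments of a connected set to an induced cycle -/

namespace SimpleGraph

variable {V : Type*} {G H : SimpleGraph V}

/-- `d 0, …, d r` is an induced path in `D` that is adjacent to `x` exactly in its first vertex
and to `y` exactly in its last vertex. -/
structure IsLink (G : SimpleGraph V) (D : Set V) (x y : V) (r : ℕ) (d : ℕ → V) : Prop where
  path : IsIndPath G r d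
  mem : ∀ t ≤ r, d t ∈ D
  left : ∀ t ≤ r, G.Adj (d t) x ↔ t = 0
  right : ∀ t ≤ r, G.Adj (d t) y ↔ t = r

theorem IsLink.reverse {D : Set V} {x y : V} {r : ℕ} {d : ℕ → V} (h : IsLink G D x y r d) :
    IsLink G D y x r (fun t => d (r - t)) where
  path := h.path.reverse
  mem t _ := h.mem _ (by omega)
  left t _ := by rw [h.right _ (by omega)]; omega
  right t _ := by rw [h.left _ (by omega)]; omega

section

variable {k : ℕ} {c : ℕ → V} {D : Set V}

/-- A link between two vertices of an induced cycle closes an induced cycle together with an arc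
of the cycle, provided that the link avoids the interior of the arc and the arc has no chord. -/
theorem IsLink.arc (hSC : ∀ m, HasInducedCycle G m → m = k) (hc : IsIndCycle G k c)
    (hD : ∀ s, c s ∉ D) {p q r : ℕ} {d : ℕ → V} (h : IsLink G D (c p) (c q) r d)
    (hpq : p < q) (hq : q + 2 ≤ p + k)
    (hav : ∀ s, p < s → s < q → ∀ t ≤ r, ¬ G.Adj (d t) (c s)) :
    r + 2 + (q - p) = k := by
  obtain ⟨a, rfl⟩ : ∃ a, q = p + a := ⟨q - p, by omega⟩
  have hcon : ∀ t ≤ r, ∀ s ≤ a, G.Adj (d t) (c (p + s)) ↔ (t = 0 ∧ s = 0) ∨ (t = r ∧ s = a) := by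
    intro t ht s hs
    rcases Nat.eq_zero_or_pos s with rfl | hs0
    · rw [Nat.add_zero, h.left t ht]; omega
    · rcases hs.eq_or_lt with rfl | hsa
      · rw [h.right t ht]; omega
      · have := hav (p + s) (by omega) (by omega) t ht
        simp only [this, false_iff]
        omega
  have hcyc : HasInducedCycle G (a + 1 + r + 1) := by
    refine hasInducedCycle_of_seq (by omega)
      (f := fun u => if u ≤ a then c (p + u) else d (r - (u - a - 1))) ?_
    intro s t hst ht
    by_cases hs : s ≤ a <;> by_cases hta : t ≤ a
    · rw [if_pos hs, if_pos hta]
      refine ⟨hc.ne _ _ (by omega) (by omega), ?_⟩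
      rw [hc.adj_iff _ _ (by omega) (by omega)]
      omega
    · rw [if_pos hs, if_neg hta]
      refine ⟨fun heq => hD (p + s) (heq ▸ h.mem _ (by omega)), ?_⟩
      rw [G.adj_comm, hcon _ (by omega) _ hs]
      omega
    · omega
    · rw [if_neg hs, if_neg hta]
      have := h.path (r - (t - a - 1)) (r - (s - a - 1)) (by omega) (by omega)
      refine ⟨this.1.symm, ?_⟩
      rw [G.adj_comm, this.2]
      omega
  have := hSC _ hcyc
  omega

/-- A vertex outside an induced cycle has at most one neighbour on it: two consecutive neighbours
leave room only for induced cycles that are too short. -/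
theorem IsIndCycle.not_two_adj (hk : 5 ≤ k) (hSC : ∀ m, HasInducedCycle G m → m = k)
    (hc : IsIndCycle G k c) {v : V} (hv : ∀ s, c s ≠ v) {i j : ℕ} (hij : i < j) (hj : j < i + k)
    (hvi : G.Adj v (c i)) (hvj : G.Adj v (c j)) : False := by
  classical
  have hex : ∃ j, i < j ∧ j < i + k ∧ G.Adj v (c j) := ⟨j, hij, hj, hvj⟩
  obtain ⟨h1, h2, h3⟩ := Nat.find_spec hex
  have hmin := fun m => @Nat.find_min _ _ hex m
  -- `q` is the first contact after `i`
  set q := Nat.find hex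
  have hpath : IsIndPath G 0 (fun _ => v) := fun s t _ _ => by omega
  have hlink : ∀ a b, G.Adj v (c a) → G.Adj v (c b) →
      IsLink G {v} (c a) (c b) 0 (fun _ => v) := fun a b ha hb =>
    ⟨hpath, fun _ _ => rfl, fun t ht => by simp [ha]; omega, fun t ht => by simp [hb]; omega⟩
  have hnext : ¬ G.Adj v (c (q + 1)) := fun h => by
    have := (hlink q (q + 1) h3 h).arc hSC hc hv (by omega) (by omega)
      (fun s _ _ => by omega)
    omega
  have hvik : G.Adj v (c (i + k)) := by rwa [hc.periodic]
  have hqk : q + 2 ≤ i + k := by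
    by_contra h
    exact hnext (by rwa [show q + 1 = i + k by omega])
  have h4 := (hlink i q hvi h3).arc hSC hc hv (by omega) (by omega)
    (fun s h1 h2' _ _ h => hmin s h2' ⟨h1, by omega, h⟩)
  have h5 := (hlink q (i + k) h3 hvik).arc hSC hc hv (by omega) (by omega)
    (fun s h1 h2' _ _ h => hnext (by rwa [show q + 1 = s by omega]))
  omega

/-- The only vertices of the induced cycle `c` that have neighbours in `D` are `c i`, `c j` and
`c l`, listed along the cycle. -/
structure IsTripleContact (G : SimpleGraph V) (k : ℕ) (c : ℕ → V) (D : Set V) (i j l : ℕ) :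
    Prop where
  ij : i < j
  jl : j < l
  li : l < i + k
  adj_i : ∃ d ∈ D, G.Adj d (c i)
  adj_j : ∃ d ∈ D, G.Adj d (c j)
  adj_l : ∃ d ∈ D, G.Adj d (c l)
  only : ∀ s, i ≤ s → s < i + k → ∀ d ∈ D, G.Adj d (c s) → s = i ∨ s = j ∨ s = l

theorem IsTripleContact.rotate (hc : IsIndCycle G k c) {i j l : ℕ}
    (h : IsTripleContact G k c D i j l) : IsTripleContact G k c D j l (i + k) where
  ij := h.jl
  jl := h.li
  li := by have := h.ij; omega
  adj_i := h.adj_j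
  adj_j := h.adj_l
  adj_l := by rw [hc.periodic]; exact h.adj_i
  only s h1 h2 d hd hds := by
    have hij := h.ij
    have hjl := h.jl
    have hli := h.li
    by_cases hs : s < i + k
    · have := h.only s (by omega) hs d hd hds
      omega
    · obtain ⟨u, rfl⟩ : ∃ u, s = u + k := ⟨s - k, by omega⟩
      rw [hc.periodic] at hds
      have := h.only u (by omega) (by omega) d hd hds
      omega

/-- The arcs of the cycle between the three contacts have lengths with sum `k`. A link from the first
contact to the second that also touches the third splits into two links
that end in the third contact; closing all of them by arcs leaves no solution for the lengths. -/
theorem IsTripleContact.not_adj_third (hk : 5 ≤ k) (hSC : ∀ m, HasInducedCycle G m → m = k)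
    (hc : IsIndCycle G k c) (hD : ∀ s, c s ∉ D) {i j l : ℕ} (h : IsTripleContact G k c D i j l)
    {r : ℕ} {d : ℕ → V} (hd : IsLink G D (c i) (c j) r d) {t : ℕ} (ht : t ≤ r) :
    ¬ G.Adj (d t) (c l) := by
  classical
  intro htl
  have hij := h.ij
  have hjl := h.jl
  have hli := h.li
  have hex : ∃ t, t ≤ r ∧ G.Adj (d t) (c l) := ⟨t, ht, htl⟩
  obtain ⟨ht1, ht1l⟩ := Nat.find_spec hex
  have hmin1 := fun m => @Nat.find_min _ _ hex m
  set t₁ := Nat.find hex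
  have hex' : ∃ u, u ≤ r ∧ G.Adj (d (r - u)) (c l) := ⟨r - t, by omega, by
    rwa [show r - (r - t) = t by omega]⟩
  obtain ⟨ht2, ht2l⟩ := Nat.find_spec hex'
  have hmin2 := fun m => @Nat.find_min _ _ hex' m
  set u₂ := Nat.find hex'
  have hone : ∀ u ≤ r, ∀ a b, a < b → b < a + k → G.Adj (d u) (c a) → ¬ G.Adj (d u) (c b) :=
    fun u hu a b hab hb h1 h2 => hc.not_two_adj hk hSC
      (fun s hs => hD s (hs ▸ hd.mem u hu)) hab hb h1 h2
  have ht1r : t₁ ≠ r := fun e =>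
    hone t₁ ht1 j l hjl (by omega) ((hd.right t₁ ht1).2 e) ht1l
  have hu2r : u₂ ≠ r := fun e =>
    hone (r - u₂) (by omega) i l (by omega) (by omega) ((hd.left _ (by omega)).2 (by omega)) ht2l
  have ht12 : t₁ ≤ r - u₂ := by
    by_contra hlt
    exact hmin1 (r - u₂) (by omega) ⟨by omega, ht2l⟩
  -- the part of the link up to its first contact with `c l`
  have hd1 : IsLink G D (c i) (c l) t₁ d :=
    ⟨fun s t h1 h2 => hd.path s t h1 (by omega), fun t h1 => hd.mem t (by omega),
      fun t h1 => hd.left t (by omega), fun t h1 => ⟨fun h2 => by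
        by_contra hne
        exact hmin1 t (by omega) ⟨by omega, h2⟩, by rintro rfl; exact ht1l⟩⟩
  -- the part of the link from its last contact with `c l`
  have hd2 : IsLink G D (c j) (c l) u₂ (fun t => d (r - t)) :=
    ⟨fun s t h1 h2 => hd.reverse.path s t h1 (by omega), fun t h1 => hd.mem _ (by omega),
      fun t h1 => hd.reverse.left t (by omega), fun t h1 => ⟨fun h2 => by
        by_contra hne
        exact hmin2 t (by omega) ⟨by omega, h2⟩, by rintro rfl; exact ht2l⟩⟩
  have e1 := hd.arc hSC hc hD hij (by omega) (fun s h1 h2 t ht h3 => by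
    have := h.only s (by omega) (by omega) _ (hd.mem t ht) h3
    omega)
  have hd1' : IsLink G D (c l) (c (i + k)) t₁ (fun t => d (t₁ - t)) := by
    rw [hc.periodic]; exact hd1.reverse
  have e2 := hd1'.arc hSC hc hD hli (by omega) (fun s h1 h2 t ht h3 => by
    have := h.only s (by omega) (by omega) _ (hd1'.mem t ht) h3
    omega)
  have e3 := hd2.arc hSC hc hD hjl (by omega) (fun s h1 h2 t ht h3 => by
    have := h.only s (by omega) (by omega) _ (hd2.mem t ht) h3
    omega)
  have e4 : l + 2 ≤ i + k → t₁ + 2 + (l - i) = k := fun hl =>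
    hd1.arc hSC hc hD (by omega) hl (fun s h1 h2 t ht h3 => by
      have := h.only s (by omega) (by omega) _ (hd1.mem t ht) h3
      have hs : s = j := by omega
      subst hs
      have := (hd.right t (by omega)).1 h3
      omega)
  have hd2' : IsLink G D (c l) (c (j + k)) u₂ (fun t => d (r - (u₂ - t))) := by
    rw [hc.periodic]; exact hd2.reverse
  have e5 : j + k + 2 ≤ l + k → u₂ + 2 + (j + k - l) = k := fun hl =>
    hd2'.arc hSC hc hD (by omega) hl (fun s h1 h2 t ht h3 => by
      by_cases hs : s < i + k
      · have := h.only s (by omega) (by omega) _ (hd2'.mem t ht) h3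
        omega
      · obtain ⟨u, rfl⟩ : ∃ u, s = u + k := ⟨s - k, by omega⟩
        rw [hc.periodic] at h3
        have := h.only u (by omega) (by omega) _ (hd2'.mem t ht) h3
        have hs : u = i := by omega
        subst hs
        have := (hd.left _ (by omega)).1 h3
        omega)
  omega

/-- Consecutive contacts among exactly three are adjacent or antipodal on the cycle. -/
theorem IsTripleContact.arc_eq (hk : 5 ≤ k) (hSC : ∀ m, HasInducedCycle G m → m = k)
    (hc : IsIndCycle G k c) (hconn : IsConn G D) (hD : ∀ s, c s ∉ D) {i j l : ℕ}
    (h : IsTripleContact G k c D i j l) : j = i + 1 ∨ 2 * (j - i) = k := by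
  have hij := h.ij
  have hjl := h.jl
  have hli := h.li
  obtain ⟨r, d, h1, h2, h3, h4⟩ := hconn.exists_indPath (fun v => G.Adj v (c i))
    (fun v => G.Adj v (c j)) h.adj_i h.adj_j
  have hd : IsLink G D (c i) (c j) r d := ⟨h1, h2, h3, h4⟩
  have e1 := hd.arc hSC hc hD hij (by omega) (fun s h1 h2 t ht h3 => by
    have := h.only s (by omega) (by omega) _ (hd.mem t ht) h3
    omega)
  by_contra hne
  have hd' : IsLink G D (c j) (c (i + k)) r (fun t => d (r - t)) := by
    rw [hc.periodic]; exact hd.reverse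
  have e2 := hd'.arc hSC hc hD (by omega) (by omega) (fun s h1 h2 t ht h3 => by
    have := h.only s (by omega) (by omega) _ (hd'.mem t ht) h3
    have hs : s = l := by omega
    subst hs
    exact h.not_adj_third hk hSC hc hD hd (by omega) h3)
  omega

theorem not_isTripleContact (hk : 5 ≤ k) (hSC : ∀ m, HasInducedCycle G m → m = k)
    (hc : IsIndCycle G k c) (hconn : IsConn G D) (hD : ∀ s, c s ∉ D) {i j l : ℕ} :
    ¬ IsTripleContact G k c D i j l := by
  intro h
  have h1 := h.arc_eq hk hSC hc hconn hD
  have h2 := (h.rotate hc).arc_eq hk hSC hc hconn hD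
  have h3 := ((h.rotate hc).rotate hc).arc_eq hk hSC hc hconn hD
  have hij := h.ij
  have hjl := h.jl
  have hli := h.li
  omega

/-- A connected set outside an induced cycle has at most two neighbours on the cycle, when all
induced cycles have the same length `k ≥ 5`. -/
theorem IsIndCycle.exists_contacts_subset_pair [Finite V] (hk : 5 ≤ k)
    (hSC : ∀ m, HasInducedCycle G m → m = k) (hc : IsIndCycle G k c)
    (hconn : IsConn G D) (hD : ∀ s, c s ∉ D) :
    ∃ x y, ∀ s < k, (∃ d ∈ D, G.Adj d (c s)) → s = x ∨ s = y := by
  by_contra! hno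
  have hone : ∀ v ∈ D, ∃ w, ∀ s < k, G.Adj v (c s) → s = w := by
    intro v hv
    by_cases hex : ∃ w < k, G.Adj v (c w)
    · obtain ⟨w, hw, hvw⟩ := hex
      refine ⟨w, fun s hs hvs => ?_⟩
      by_contra hne
      have hv' : ∀ s, c s ≠ v := fun s hs => hD s (hs ▸ hv)
      rcases lt_or_gt_of_ne hne with hlt | hlt
      · exact hc.not_two_adj hk hSC hv' hlt (by omega) hvs hvw
      · exact hc.not_two_adj hk hSC hv' hlt (by omega) hvw hvs
    · push Not at hex
      exact ⟨0, fun s hs hvs => absurd hvs (hex s hs)⟩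
  -- a largest connected part of `D` with at most three contacts has exactly three
  let F : Set (Set V) := {T | T ⊆ D ∧ IsConn G T ∧
    ∃ x y z, ∀ s < k, (∃ d ∈ T, G.Adj d (c s)) → s = x ∨ s = y ∨ s = z}
  have hF : F.Nonempty := by
    obtain ⟨v, hv⟩ := hconn.1
    obtain ⟨w, hw⟩ := hone v hv
    refine ⟨{v}, by simpa using hv, isConn_singleton G v, w, w, w, ?_⟩
    rintro s hs ⟨d, rfl, hd⟩
    exact Or.inl (hw s hs hd)
  obtain ⟨T, ⟨hTD, hT, x, y, z, hxyz⟩, hmax⟩ := (Set.toFinite F).exists_maximal hF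
  have hmany : ∀ x y, ∃ s < k, (∃ d ∈ T, G.Adj d (c s)) ∧ s ≠ x ∧ s ≠ y := by
    by_cases hTe : T = D
    · exact hTe ▸ hno
    · by_contra! hfew
      obtain ⟨p, q, hpq⟩ := hfew
      obtain ⟨a, ha, b, hb, hab⟩ := hconn.2 T hTD hT.1 hTe
      obtain ⟨w, hw⟩ := hone b hb.1
      have hmem : T ∪ {b} ∈ F := by
        refine ⟨Set.union_subset hTD (by simpa using hb.1),
          hT.union (isConn_singleton G b) ⟨a, ha, b, rfl, hab⟩, p, q, w, ?_⟩
        rintro s hs ⟨d, hd | rfl, hds⟩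
        · by_cases hsp : s = p
          · exact Or.inl hsp
          · exact Or.inr (Or.inl (hpq s hs ⟨d, hd, hds⟩ hsp))
        · exact Or.inr (Or.inr (hw s hs hds))
      exact hb.2 (hmax hmem Set.subset_union_left (Or.inr rfl))
  obtain ⟨x', hx', hxc, hx1, hx2⟩ := hmany y z
  obtain rfl : x' = x := by have := hxyz x' hx' hxc; omega
  obtain ⟨y', hy', hyc, hy1, hy2⟩ := hmany x' z
  obtain rfl : y' = y := by have := hxyz y' hy' hyc; omega
  obtain ⟨z', hz', hzc, hz1, hz2⟩ := hmany x' y'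
  obtain rfl : z' = z := by have := hxyz z' hz' hzc; omega
  have hD' : ∀ s, c s ∉ T := fun s hs => hD s (hTD hs)
  have key : ∀ i j l, i < j → j < l → l < k → (∃ d ∈ T, G.Adj d (c i)) →
      (∃ d ∈ T, G.Adj d (c j)) → (∃ d ∈ T, G.Adj d (c l)) →
      (∀ s < k, (∃ d ∈ T, G.Adj d (c s)) → s = i ∨ s = j ∨ s = l) → False := by
    intro i j l hij hjl hl hi hj hl' hon
    refine not_isTripleContact hk hSC hc hT hD' ⟨hij, hjl, by omega, hi, hj, hl', ?_⟩
    intro s h1 h2 d hd hds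
    by_cases hs : s < k
    · exact hon s hs ⟨d, hd, hds⟩
    · obtain ⟨u, rfl⟩ : ∃ u, s = u + k := ⟨s - k, by omega⟩
      rw [hc.periodic] at hds
      have := hon u (by omega) ⟨d, hd, hds⟩
      omega
  rcases lt_or_gt_of_ne hy1 with h1 | h1 <;> rcases lt_or_gt_of_ne hz1 with h2 | h2 <;>
    rcases lt_or_gt_of_ne hz2 with h3 | h3
  · exact key _ _ _ h3 h1 hx' hzc hyc hxc (fun s hs h => by have := hxyz s hs h; omega)
  · exact key _ _ _ h3 h2 hx' hyc hzc hxc (fun s hs h => by have := hxyz s hs h; omega)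
  · omega
  · exact key _ _ _ h1 h2 hz' hyc hxc hzc (fun s hs h => by have := hxyz s hs h; omega)
  · exact key _ _ _ h2 h1 hy' hzc hxc hyc (fun s hs h => by have := hxyz s hs h; omega)
  · omega
  · exact key _ _ _ h2 h3 hy' hxc hzc hyc (fun s hs h => by have := hxyz s hs h; omega)
  · exact key _ _ _ h1 h3 hz' hxc hyc hzc (fun s hs h => by have := hxyz s hs h; omega)

end

end SimpleGraph

/-! ### Minors isomorphic to the complete graph on four vertices -/

namespace SimpleGraph

variable {V : Type*} {G H : SimpleGraph V}

/-- The subgraph of `G` induced by `W` has a minor isomorphic to the complete graph on four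
vertices: four disjoint connected branch sets in `W` that are pairwise joined by edges. -/
def HasK4Model (G : SimpleGraph V) (W : Set V) : Prop :=
  ∃ A : Fin 4 → Set V, (∀ i, A i ⊆ W) ∧ (∀ i, IsConn G (A i)) ∧
    (∀ i j, i ≠ j → Disjoint (A i) (A j)) ∧ ∀ i j, i ≠ j → ∃ a ∈ A i, ∃ b ∈ A j, G.Adj a b

theorem HasK4Model.mono {W W' : Set V} (hW : W' ⊆ W) (h : HasK4Model G W') : HasK4Model G W := by
  obtain ⟨A, h1, h2⟩ := h
  exact ⟨A, fun i => (h1 i).trans hW, h2⟩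

/-- Add to `u` all neighbours of `w`. -/
def mergeInto (H : SimpleGraph V) (u w : V) : SimpleGraph V :=
  fromRel fun a b => H.Adj a b ∨ (a = u ∧ H.Adj w b)

theorem mergeInto_adj {u w : V} (huw : ¬ H.Adj u w) {a b : V} :
    (H.mergeInto u w).Adj a b ↔ H.Adj a b ∨ (a = u ∧ H.Adj w b) ∨ (b = u ∧ H.Adj w a) := by
  have h1 := H.adj_comm a b
  simp only [mergeInto, fromRel_adj]
  constructor
  · rintro ⟨-, h⟩
    tauto
  · intro h
    refine ⟨?_, by tauto⟩
    rintro rfl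
    rcases h with h | ⟨rfl, h⟩ | ⟨rfl, h⟩
    · exact H.irrefl h
    · exact huw h.symm
    · exact huw h.symm

/-- Folding `v` onto its neighbours `u` and `w` is the contraction of `v`, `u`, `w` to the vertex
`u`, so it creates no new minor. -/
theorem HasK4Model.of_mergeInto {W : Set V} {v u w : V} (huw : ¬ H.Adj u w)
    (hv : v ∈ W) (hw : w ∈ W) (hvuw : (H.Adj v u ∧ H.Adj v w) ∨ u = v)
    (h : HasK4Model (H.mergeInto u w) (W \ {v, w})) : HasK4Model H W := by
  obtain ⟨A, hAW, hconn, hdisj, hadj⟩ := h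
  have hvA : ∀ i, v ∉ A i := fun i hi => by simpa using (hAW i hi).2
  have hwA : ∀ i, w ∉ A i := fun i hi => by simpa using (hAW i hi).2
  have huA : ∀ i, u ∈ A i → H.Adj v u ∧ H.Adj v w := fun i hi => by
    rcases hvuw with h | rfl
    · exact h
    · exact absurd hi (hvA i)
  refine ⟨fun i => A i ∪ {x | (x = v ∨ x = w) ∧ u ∈ A i}, fun i => ?_, fun i => ?_,
    fun i j hij => ?_, fun i j hij => ?_⟩
  · rintro x (hx | ⟨rfl | rfl, -⟩)
    · exact (hAW i hx).1
    · exact hv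
    · exact hw
  · refine ⟨(hconn i).1.mono Set.subset_union_left, fun T hT hne hTn => ?_⟩
    by_contra! hcut
    have hsame : ∀ x y, H.Adj x y → x ∈ A i ∪ {x | (x = v ∨ x = w) ∧ u ∈ A i} →
        y ∈ A i ∪ {x | (x = v ∨ x = w) ∧ u ∈ A i} → (x ∈ T ↔ y ∈ T) := by
      intro x y hxy hx hy
      constructor
      · intro hxT
        by_contra hyT
        exact hcut x hxT y ⟨hy, hyT⟩ hxy
      · intro hyT
        by_contra hxT
        exact hcut y hyT x ⟨hx, hxT⟩ hxy.symm
    have hstar : u ∈ A i → (v ∈ T ↔ u ∈ T) ∧ (w ∈ T ↔ u ∈ T) := by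
      intro hu
      have h1 := hsame v u (huA i hu).1 (Or.inr ⟨Or.inl rfl, hu⟩) (Or.inl hu)
      have h2 := hsame v w (huA i hu).2 (Or.inr ⟨Or.inl rfl, hu⟩) (Or.inr ⟨Or.inr rfl, hu⟩)
      exact ⟨h1, h2.symm.trans h1⟩
    have hT0 : (T ∩ A i).Nonempty := by
      obtain ⟨x, hx⟩ := hne
      rcases hT hx with hxA | ⟨rfl | rfl, hu⟩
      · exact ⟨x, hx, hxA⟩
      · exact ⟨u, (hstar hu).1.1 hx, hu⟩
      · exact ⟨u, (hstar hu).2.1 hx, hu⟩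
    have hT1 : T ∩ A i ≠ A i := by
      intro heq
      have hsub : A i ⊆ T := Set.inter_eq_right.1 heq
      refine hTn (Set.Subset.antisymm hT ?_)
      rintro x (hxA | ⟨rfl | rfl, hu⟩)
      · exact hsub hxA
      · exact (hstar hu).1.2 (hsub hu)
      · exact (hstar hu).2.2 (hsub hu)
    obtain ⟨a, ⟨haT, haA⟩, b, ⟨hbA, hbT⟩, hab⟩ := (hconn i).2 _ Set.inter_subset_right hT0 hT1
    have hbT' : b ∉ T := fun h => hbT ⟨h, hbA⟩
    rcases (mergeInto_adj huw).1 hab with h | ⟨rfl, h⟩ | ⟨rfl, h⟩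
    · exact hbT' ((hsame a b h (Or.inl haA) (Or.inl hbA)).1 haT)
    · exact hbT' ((hsame w b h (Or.inr ⟨Or.inr rfl, haA⟩) (Or.inl hbA)).1 ((hstar haA).2.2 haT))
    · exact hbT' ((hstar hbA).2.1 ((hsame w a h (Or.inr ⟨Or.inr rfl, hbA⟩) (Or.inl haA)).2 haT))
  · have hd := Set.disjoint_left.1 (hdisj i j hij)
    rw [Set.disjoint_left]
    rintro x (hx | ⟨hx, hu⟩) (hx' | ⟨hx', hu'⟩)
    · exact hd hx hx'
    · rcases hx' with rfl | rfl
      · exact hvA _ hx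
      · exact hwA _ hx
    · rcases hx with rfl | rfl
      · exact hvA _ hx'
      · exact hwA _ hx'
    · exact hd hu hu'
  · obtain ⟨a, ha, b, hb, hab⟩ := hadj i j hij
    rcases (mergeInto_adj huw).1 hab with h | ⟨rfl, h⟩ | ⟨rfl, h⟩
    · exact ⟨a, Or.inl ha, b, Or.inl hb, h⟩
    · exact ⟨w, Or.inr ⟨Or.inr rfl, ha⟩, b, Or.inl hb, h⟩
    · exact ⟨a, Or.inl ha, w, Or.inr ⟨Or.inr rfl, hb⟩, h.symm⟩

/-- `f 0, …, f m` are the vertices of a path. -/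
structure IsPathSeq (G : SimpleGraph V) (m : ℕ) (f : ℕ → V) : Prop where
  ne : ∀ s t, s < t → t ≤ m → f s ≠ f t
  adj : ∀ t < m, G.Adj (f t) (f (t + 1))

theorem IsIndPath.isPathSeq {m : ℕ} {f : ℕ → V} (h : IsIndPath G m f) : IsPathSeq G m f :=
  ⟨fun s t h1 h2 => (h s t h1 h2).1, fun _ ht => h.adj ht⟩

/-- The sequence `f 0, …, f m, g 0, g 1, …`. -/
def appendSeq (m : ℕ) (f g : ℕ → V) (t : ℕ) : V := if t ≤ m then f t else g (t - m - 1)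

theorem appendSeq_left {m t : ℕ} (f g : ℕ → V) (h : t ≤ m) : appendSeq m f g t = f t := if_pos h

theorem appendSeq_right (m t : ℕ) (f g : ℕ → V) : appendSeq m f g (m + 1 + t) = g t := by
  rw [appendSeq, if_neg (by omega), show m + 1 + t - m - 1 = t by omega]

theorem IsPathSeq.append {m n : ℕ} {f g : ℕ → V} (hf : IsPathSeq G m f) (hg : IsPathSeq G n g)
    (hfg : ∀ s ≤ m, ∀ t ≤ n, f s ≠ g t) (hadj : G.Adj (f m) (g 0)) :
    IsPathSeq G (m + 1 + n) (appendSeq m f g) := by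
  have hcase : ∀ t, t ≤ m + 1 + n → t ≤ m ∨ ∃ u ≤ n, t = m + 1 + u := fun t ht => by
    by_cases h : t ≤ m
    · exact Or.inl h
    · exact Or.inr ⟨t - m - 1, by omega, by omega⟩
  refine ⟨fun s t hst ht => ?_, fun t ht => ?_⟩
  · rcases hcase s (by omega) with hs | ⟨s, hs, rfl⟩ <;> rcases hcase t ht with ht | ⟨t, ht, rfl⟩
    · rw [appendSeq_left _ _ hs, appendSeq_left _ _ ht]
      exact hf.ne s t hst ht
    · rw [appendSeq_left _ _ hs, appendSeq_right]
      exact hfg s hs t (by omega)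
    · omega
    · rw [appendSeq_right, appendSeq_right]
      exact hg.ne s t (by omega) (by omega)
  · rcases hcase t (by omega) with h | ⟨t, h, rfl⟩
    · rcases h.eq_or_lt with rfl | h
      · rw [appendSeq_left _ _ le_rfl, show t + 1 = t + 1 + 0 from rfl, appendSeq_right]
        exact hadj
      · rw [appendSeq_left _ _ h.le, appendSeq_left _ _ h]
        exact hf.adj t h
    · rw [appendSeq_right, add_assoc (m + 1), appendSeq_right]
      exact hg.adj t (by omega)

/-- A cycle `f 0, …, f m`, not necessarily induced, together with a connected set `D` outside the
cycle that has at least three neighbours on it: no two positions cover all neighbours. -/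
structure IsHub (G : SimpleGraph V) (m : ℕ) (f : ℕ → V) (D : Set V) : Prop where
  two_le : 2 ≤ m
  path : IsPathSeq G m f
  closed : G.Adj (f m) (f 0)
  conn : IsConn G D
  notMem : ∀ t ≤ m, f t ∉ D
  contact : ∀ x y, ∃ t ≤ m, t ≠ x ∧ t ≠ y ∧ ∃ d ∈ D, G.Adj d (f t)

/-- A chord of the cycle of a hub yields a hub with a shorter cycle: either one of the two cycles
formed by the chord still has three contacts, or the inner part of one arc can be moved into the
connected set, which then touches both ends of the chord and a vertex of the other arc. -/
theorem IsHub.exists_shorter {m : ℕ} {f : ℕ → V} {D : Set V} (h : IsHub G m f D) {p q : ℕ}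
    (hpq : p + 1 < q) (hq : q ≤ m) (hne : ¬ (p = 0 ∧ q = m)) (hadj : G.Adj (f p) (f q)) :
    ∃ m' < m, ∃ f' D', IsHub G m' f' D' := by
  have houter : ∀ D', IsConn G D' → (∀ t ≤ m, t ≤ p ∨ q ≤ t → f t ∉ D') →
      (∀ x y, ∃ t ≤ m, (t ≤ p ∨ q ≤ t) ∧ t ≠ x ∧ t ≠ y ∧ ∃ d ∈ D', G.Adj d (f t)) →
      ∃ m' < m, ∃ f' D', IsHub G m' f' D' := by
    intro D' hD' hnot hcon
    have hmem : ∀ t ≤ m - (q - p - 1), (if t ≤ p then t else t + (q - p - 1)) ≤ m ∧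
        ((if t ≤ p then t else t + (q - p - 1)) ≤ p ∨
          q ≤ (if t ≤ p then t else t + (q - p - 1))) := by
      intro t ht
      split_ifs <;> omega
    refine ⟨m - (q - p - 1), by omega, fun t => f (if t ≤ p then t else t + (q - p - 1)), D',
      by omega, ⟨fun s t hst ht => h.path.ne _ _ ?_ (hmem t ht).1, fun t ht => ?_⟩, ?_, hD',
      fun t ht => hnot _ (hmem t ht).1 (hmem t ht).2, fun x y => ?_⟩
    · split_ifs <;> omega
    · rcases lt_trichotomy t p with h1 | rfl | h1
      · rw [if_pos h1.le, if_pos (by omega)]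
        exact h.path.adj t (by omega)
      · rw [if_pos le_rfl, if_neg (by omega), show t + 1 + (q - t - 1) = q by omega]
        exact hadj
      · rw [if_neg (by omega), if_neg (by omega),
          show t + 1 + (q - p - 1) = t + (q - p - 1) + 1 by omega]
        exact h.path.adj _ (by omega)
    · rw [if_neg (by omega), if_pos (by omega),
        show m - (q - p - 1) + (q - p - 1) = m by omega]
      exact h.closed
    · obtain ⟨t, htm, ht, htx, hty, hd⟩ := hcon (if x ≤ p then x else x + (q - p - 1))
        (if y ≤ p then y else y + (q - p - 1))
      by_cases htp : t ≤ p
      · refine ⟨t, by omega, ?_, ?_, by rwa [if_pos htp]⟩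
        · rintro rfl; simp [htp] at htx
        · rintro rfl; simp [htp] at hty
      · refine ⟨t - (q - p - 1), by omega, ?_, ?_, by
          rwa [if_neg (by omega), show t - (q - p - 1) + (q - p - 1) = t by omega]⟩
        · rintro rfl; rw [if_neg (by omega)] at htx; omega
        · rintro rfl; rw [if_neg (by omega)] at hty; omega
  by_cases hin : ∃ e, p < e ∧ e < q ∧ ∃ d ∈ D, G.Adj d (f e)
  · by_cases hout : ∃ o ≤ m, (o < p ∨ q < o) ∧ ∃ d ∈ D, G.Adj d (f o)
    · obtain ⟨e, he1, he2, d, hd, hde⟩ := hin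
      obtain ⟨o, ho, hopq, d', hd', hdo⟩ := hout
      refine houter (D ∪ f '' Set.Icc (p + 1) (q - 1)) (h.conn.union
        (isConn_image_Icc (by omega) fun t h1 h2 => h.path.adj t (by omega))
        ⟨d, hd, f e, ⟨e, ⟨by omega, by omega⟩, rfl⟩, hde⟩) ?_ ?_
      · rintro t ht htpq (htD | ⟨s, ⟨hs1, hs2⟩, hst⟩)
        · exact h.notMem t ht htD
        · rcases htpq with h1 | h1
          · exact h.path.ne t s (by omega) (by omega) hst.symm
          · exact h.path.ne s t (by omega) (by omega) hst
      · intro x y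
        have c1 : ∃ d ∈ D ∪ f '' Set.Icc (p + 1) (q - 1), G.Adj d (f p) :=
          ⟨f (p + 1), Or.inr ⟨p + 1, ⟨by omega, by omega⟩, rfl⟩, (h.path.adj p (by omega)).symm⟩
        have c2 : ∃ d ∈ D ∪ f '' Set.Icc (p + 1) (q - 1), G.Adj d (f q) :=
          ⟨f (q - 1), Or.inr ⟨q - 1, ⟨by omega, by omega⟩, rfl⟩, by
            have := h.path.adj (q - 1) (by omega)
            rwa [show q - 1 + 1 = q by omega] at this⟩
        by_cases hp : p ≠ x ∧ p ≠ y
        · exact ⟨p, by omega, by omega, hp.1, hp.2, c1⟩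
        · by_cases hq' : q ≠ x ∧ q ≠ y
          · exact ⟨q, by omega, by omega, hq'.1, hq'.2, c2⟩
          · exact ⟨o, ho, by omega, by omega, by omega, d', Or.inl hd', hdo⟩
    · refine ⟨q - p, by omega, fun t => f (p + t), D, by omega,
        ⟨fun s t hst ht => h.path.ne _ _ (by omega) (by omega), fun t ht => ?_⟩, ?_, h.conn,
        fun t ht => h.notMem _ (by omega), fun x y => ?_⟩
      · exact h.path.adj (p + t) (by omega)
      · rw [show p + (q - p) = q by omega]
        exact hadj.symm
      · obtain ⟨t, ht, htx, hty, hd⟩ := h.contact (p + x) (p + y)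
        have : p ≤ t ∧ t ≤ q := by
          by_contra hcon
          exact hout ⟨t, ht, by omega, hd⟩
        refine ⟨t - p, by omega, by omega, by omega, ?_⟩
        rwa [show p + (t - p) = t by omega]
  · refine houter D h.conn (fun t ht _ => h.notMem t ht) fun x y => ?_
    obtain ⟨t, ht, htx, hty, hd⟩ := h.contact x y
    refine ⟨t, ht, ?_, htx, hty, hd⟩
    by_contra hcon
    exact hin ⟨t, by omega, by omega, hd⟩

theorem not_isHub [Finite V] {k : ℕ} (hk : 5 ≤ k) (hSC : ∀ m, HasInducedCycle G m → m = k)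
    {m : ℕ} {f : ℕ → V} {D : Set V} : ¬ IsHub G m f D := by
  induction m using Nat.strong_induction_on generalizing f D with
  | _ m ih =>
    intro h
    have hseq : ∀ s t, s < t → t ≤ m →
        f s ≠ f t ∧ (G.Adj (f s) (f t) ↔ t = s + 1 ∨ (s = 0 ∧ t = m)) := by
      intro s t hst ht
      refine ⟨h.path.ne s t hst ht, fun hadj => ?_, ?_⟩
      · by_contra hne
        obtain ⟨m', hm', f', D', h'⟩ := h.exists_shorter (p := s) (q := t) (by omega) ht
          (by omega) hadj
        exact ih m' hm' h'
      · rintro (rfl | ⟨rfl, rfl⟩)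
        · exact h.path.adj s (by omega)
        · exact h.closed.symm
    have hmk := hSC _ (hasInducedCycle_of_seq h.two_le hseq)
    subst hmk
    have hlt : ∀ s, s % (m + 1) ≤ m := fun s => Nat.lt_succ_iff.1 (Nat.mod_lt s (by omega))
    obtain ⟨x, y, hxy⟩ := (isIndCycle_of_seq h.two_le hseq).exists_contacts_subset_pair hk hSC
      h.conn (fun s => h.notMem _ (hlt s))
    obtain ⟨t, ht, htx, hty, hd⟩ := h.contact x y
    have := hxy t (by omega) (by rwa [Nat.mod_eq_of_lt (by omega)])
    omega

/-- A path through the connected set `A` between prescribed ends, and an enlargement of `D` inside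
`A` that touches the path. -/
theorem IsConn.exists_path_touching {A D : Set V} (hA : IsConn G A) (hD : IsConn G D)
    (hAD : Disjoint A D) (hadj : ∃ a ∈ A, ∃ d ∈ D, G.Adj a d) (X Y : V → Prop)
    (hX : ∃ a ∈ A, X a) (hY : ∃ a ∈ A, Y a) :
    ∃ (r : ℕ) (f : ℕ → V) (D' : Set V), IsPathSeq G r f ∧ (∀ t ≤ r, f t ∈ A) ∧ X (f 0) ∧ Y (f r) ∧
      IsConn G D' ∧ D ⊆ D' ∧ D' ⊆ D ∪ A ∧ (∀ t ≤ r, f t ∉ D') ∧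
      ∃ t ≤ r, ∃ d ∈ D', G.Adj d (f t) := by
  obtain ⟨r, f, hf, hfA, hfX, hfY⟩ := hA.exists_indPath X Y hX hY
  obtain ⟨s, g, hg, hgA, hgX, hgY⟩ := hA.exists_indPath (fun a => ∃ d ∈ D, G.Adj a d)
    (fun a => ∃ t ≤ r, a = f t) hadj ⟨f 0, hfA 0 (by omega), 0, by omega, rfl⟩
  have hfD : ∀ t ≤ r, f t ∉ D := fun t ht h => Set.disjoint_left.1 hAD (hfA t ht) h
  obtain ⟨t, ht, hgt⟩ := (hgY s le_rfl).2 rfl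
  obtain ⟨d, hd, hgd⟩ := (hgX 0 (by omega)).2 rfl
  have hX0 := (hfX 0 (by omega)).2 rfl
  have hYr := (hfY r le_rfl).2 rfl
  rcases Nat.eq_zero_or_pos s with rfl | hs
  · exact ⟨r, f, D, hf.isPathSeq, hfA, hX0, hYr, hD, subset_rfl, Set.subset_union_left, hfD,
      t, ht, d, hd, hgt ▸ hgd.symm⟩
  · refine ⟨r, f, D ∪ g '' Set.Icc 0 (s - 1), hf.isPathSeq, hfA, hX0, hYr, hD.union
      (isConn_image_Icc (by omega) fun u _ h2 => hg.adj (by omega))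
      ⟨d, hd, g 0, ⟨0, ⟨by omega, by omega⟩, rfl⟩, hgd.symm⟩, Set.subset_union_left,
      Set.union_subset_union_right _ ?_, ?_, t, ht, g (s - 1),
      Or.inr ⟨s - 1, ⟨by omega, by omega⟩, rfl⟩, ?_⟩
    · rintro _ ⟨u, ⟨-, hu⟩, rfl⟩
      exact hgA u (by omega)
    · rintro u hu (h | ⟨w, ⟨-, hw⟩, hwu⟩)
      · exact hfD u hu h
      · have := (hgY w (by omega)).1 ⟨u, hu, hwu⟩
        omega
    · have := hg.adj (t := s - 1) (by omega)
      rwa [show s - 1 + 1 = s by omega, hgt] at this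

theorem HasK4Model.exists_isHub {W : Set V} (h : HasK4Model G W) : ∃ m f D, IsHub G m f D := by
  obtain ⟨A, -, hconn, hdisj, hadj⟩ := h
  have hdis : ∀ i j, i ≠ j → ∀ x, x ∈ A i → x ∉ A j := fun i j hij x hi hj =>
    Set.disjoint_left.1 (hdisj i j hij) hi hj
  obtain ⟨r₁, f₁, D₁, hf₁, hfA₁, hX₁, hY₁, hD₁, hDD₁, hDA₁, hfD₁, t₁, ht₁, d₁, hd₁, hdt₁⟩ :=
    (hconn 0).exists_path_touching (hconn 3) (hdisj 0 3 (by decide)) (hadj 0 3 (by decide))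
      (fun a => ∃ c ∈ A 2, G.Adj a c) (fun a => ∃ b ∈ A 1, G.Adj a b)
      (hadj 0 2 (by decide)) (hadj 0 1 (by decide))
  have hD1 : ∀ i, i ≠ 0 → i ≠ 3 → ∀ x ∈ A i, x ∉ D₁ := by
    intro i h0 h3 x hx hxD
    rcases hDA₁ hxD with h | h
    · exact hdis i 3 h3 x hx h
    · exact hdis i 0 h0 x hx h
  obtain ⟨b, hb, hb'⟩ := hY₁
  obtain ⟨r₂, f₂, D₂, hf₂, hfA₂, hX₂, hY₂, hD₂, hDD₂, hDA₂, hfD₂, t₂, ht₂, d₂, hd₂, hdt₂⟩ :=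
    (hconn 1).exists_path_touching hD₁ (Set.disjoint_left.2 (hD1 1 (by decide) (by decide)))
      (by obtain ⟨a, ha, d, hd, h⟩ := hadj 1 3 (by decide); exact ⟨a, ha, d, hDD₁ hd, h⟩)
      (fun b => G.Adj (f₁ r₁) b) (fun b => ∃ c ∈ A 2, G.Adj b c) ⟨b, hb, hb'⟩
      (hadj 1 2 (by decide))
  have hD2 : ∀ x ∈ A 2, x ∉ D₂ := by
    intro x hx hxD
    rcases hDA₂ hxD with h | h
    · exact hD1 2 (by decide) (by decide) x hx h
    · exact hdis 2 1 (by decide) x hx h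
  obtain ⟨c, hc, hc'⟩ := hY₂
  obtain ⟨e, he, he'⟩ := hX₁
  obtain ⟨r₃, f₃, D₃, hf₃, hfA₃, hX₃, hY₃, hD₃, hDD₃, hDA₃, hfD₃, t₃, ht₃, d₃, hd₃, hdt₃⟩ :=
    (hconn 2).exists_path_touching hD₂ (Set.disjoint_left.2 hD2)
      (by obtain ⟨a, ha, d, hd, h⟩ := hadj 2 3 (by decide); exact ⟨a, ha, d, hDD₂ (hDD₁ hd), h⟩)
      (fun b => G.Adj (f₂ r₂) b) (fun b => G.Adj b (f₁ 0)) ⟨c, hc, hc'⟩ ⟨e, he, he'.symm⟩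
  have hp₁ : IsPathSeq G (r₁ + 1 + r₂) (appendSeq r₁ f₁ f₂) := hf₁.append hf₂
    (fun s hs t ht heq => hdis 0 1 (by decide) _ (hfA₁ s hs) (heq ▸ hfA₂ t ht)) hX₂
  have hmem : ∀ t ≤ r₁ + 1 + r₂, (∃ s ≤ r₁, t = s ∧ appendSeq r₁ f₁ f₂ t = f₁ s) ∨
      ∃ s ≤ r₂, t = r₁ + 1 + s ∧ appendSeq r₁ f₁ f₂ t = f₂ s := by
    intro t ht
    by_cases h : t ≤ r₁
    · exact Or.inl ⟨t, h, rfl, appendSeq_left _ _ h⟩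
    · obtain ⟨s, rfl⟩ : ∃ s, t = r₁ + 1 + s := ⟨t - r₁ - 1, by omega⟩
      exact Or.inr ⟨s, by omega, rfl, appendSeq_right _ _ _ _⟩
  have hp₂ := hp₁.append hf₃ (by
    intro s hs t ht heq
    rcases hmem s hs with ⟨u, hu, -, h⟩ | ⟨u, hu, -, h⟩
    · exact hdis 0 2 (by decide) _ (hfA₁ u hu) (h ▸ heq ▸ hfA₃ t ht)
    · exact hdis 1 2 (by decide) _ (hfA₂ u hu) (h ▸ heq ▸ hfA₃ t ht))
    (by rw [appendSeq_right]; exact hX₃)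
  refine ⟨_, _, D₃, by omega, hp₂, ?_, hD₃, ?_, ?_⟩
  · rw [appendSeq_right, appendSeq_left _ _ (by omega), appendSeq_left _ _ (by omega)]
    exact hY₃
  · intro t ht hD
    have h12 : ∀ x, x ∈ A 0 ∨ x ∈ A 1 → x ∉ D₂ → x ∉ D₃ := by
      intro x hx h2 h3
      rcases hDA₃ h3 with h | h
      · exact h2 h
      · rcases hx with hx | hx
        · exact hdis 2 0 (by decide) _ h hx
        · exact hdis 2 1 (by decide) _ h hx
    by_cases h : t ≤ r₁ + 1 + r₂
    · rw [appendSeq_left _ _ h] at hD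
      rcases hmem t h with ⟨u, hu, -, h⟩ | ⟨u, hu, -, h⟩
      · rw [h] at hD
        refine h12 _ (Or.inl (hfA₁ u hu)) (fun h2 => ?_) hD
        rcases hDA₂ h2 with h | h
        · exact hfD₁ u hu h
        · exact hdis 0 1 (by decide) _ (hfA₁ u hu) h
      · rw [h] at hD
        exact h12 _ (Or.inr (hfA₂ u hu)) (hfD₂ u hu) hD
    · obtain ⟨s, rfl⟩ : ∃ s, t = r₁ + 1 + r₂ + 1 + s := ⟨t - (r₁ + 1 + r₂) - 1, by omega⟩
      rw [appendSeq_right] at hD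
      exact hfD₃ s (by omega) hD
  · have c₁ : ∃ d ∈ D₃, G.Adj d
        (appendSeq (r₁ + 1 + r₂) (appendSeq r₁ f₁ f₂) f₃ t₁) := by
      rw [appendSeq_left _ _ (by omega), appendSeq_left _ _ ht₁]
      exact ⟨d₁, hDD₃ (hDD₂ hd₁), hdt₁⟩
    have c₂ : ∃ d ∈ D₃, G.Adj d
        (appendSeq (r₁ + 1 + r₂) (appendSeq r₁ f₁ f₂) f₃ (r₁ + 1 + t₂)) := by
      rw [appendSeq_left _ _ (by omega), appendSeq_right]
      exact ⟨d₂, hDD₃ hd₂, hdt₂⟩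
    have c₃ : ∃ d ∈ D₃, G.Adj d
        (appendSeq (r₁ + 1 + r₂) (appendSeq r₁ f₁ f₂) f₃ (r₁ + 1 + r₂ + 1 + t₃)) := by
      rw [appendSeq_right]
      exact ⟨d₃, hd₃, hdt₃⟩
    intro x y
    by_cases h1 : t₁ ≠ x ∧ t₁ ≠ y
    · exact ⟨_, by omega, h1.1, h1.2, c₁⟩
    · by_cases h2 : r₁ + 1 + t₂ ≠ x ∧ r₁ + 1 + t₂ ≠ y
      · exact ⟨_, by omega, h2.1, h2.2, c₂⟩
      · exact ⟨_, by omega, by omega, by omega, c₃⟩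

/-- If all induced cycles of a finite graph have the same length `k ≥ 5`, then it has no minor
isomorphic to the complete graph on four vertices. -/
theorem not_hasK4Model [Finite V] {k : ℕ} (hk : 5 ≤ k) (hSC : ∀ m, HasInducedCycle G m → m = k)
    (W : Set V) : ¬ HasK4Model G W := fun h => by
  obtain ⟨m, f, D, hub⟩ := h.exists_isHub
  exact not_isHub hk hSC hub

end SimpleGraph

/-! ### Minimum degree three forces the minor -/

namespace SimpleGraph

variable {V : Type*} {G H : SimpleGraph V}

theorem hasK4Model_of_four {W A B C D : Set V} (hA : A ⊆ W) (hB : B ⊆ W) (hC : C ⊆ W) (hD : D ⊆ W)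
    (cA : IsConn G A) (cB : IsConn G B) (cC : IsConn G C) (cD : IsConn G D)
    (dAB : Disjoint A B) (dAC : Disjoint A C) (dAD : Disjoint A D) (dBC : Disjoint B C)
    (dBD : Disjoint B D) (dCD : Disjoint C D)
    (eAB : ∃ a ∈ A, ∃ b ∈ B, G.Adj a b) (eAC : ∃ a ∈ A, ∃ b ∈ C, G.Adj a b)
    (eAD : ∃ a ∈ A, ∃ b ∈ D, G.Adj a b) (eBC : ∃ a ∈ B, ∃ b ∈ C, G.Adj a b)
    (eBD : ∃ a ∈ B, ∃ b ∈ D, G.Adj a b) (eCD : ∃ a ∈ C, ∃ b ∈ D, G.Adj a b) :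
    HasK4Model G W := by
  have hsymm : ∀ {S T : Set V}, (∃ a ∈ S, ∃ b ∈ T, G.Adj a b) → ∃ a ∈ T, ∃ b ∈ S, G.Adj a b :=
    fun ⟨a, ha, b, hb, h⟩ => ⟨b, hb, a, ha, h.symm⟩
  refine ⟨![A, B, C, D], ?_, ?_, ?_, ?_⟩
  · intro i; fin_cases i <;> assumption
  · intro i; fin_cases i <;> assumption
  · intro i j hij
    fin_cases i <;> fin_cases j <;> first | exact absurd rfl hij | assumption | skip
    exacts [dAB.symm, dAC.symm, dBC.symm, dAD.symm, dBD.symm, dCD.symm]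
  · intro i j hij
    fin_cases i <;> fin_cases j <;> first | exact absurd rfl hij | assumption | skip
    exacts [hsymm eAB, hsymm eAC, hsymm eBC, hsymm eAD, hsymm eBD, hsymm eCD]

/-- Reversing the first `i` vertices of a path along a chord from its first vertex. -/
theorem IsPathSeq.rotate {m i : ℕ} {f : ℕ → V} (hf : IsPathSeq G m f) (him : i ≤ m)
    (hadj : G.Adj (f 0) (f i)) :
    IsPathSeq G m (fun t => if t < i then f (i - 1 - t) else f t) := by
  refine ⟨fun s t hst ht => ?_, fun t ht => ?_⟩
  · split_ifs with h1 h2 h2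
    · exact (hf.ne _ _ (by omega) (by omega)).symm
    · exact hf.ne _ _ (by omega) (by omega)
    · omega
    · exact hf.ne _ _ (by omega) (by omega)
  · rcases lt_trichotomy (t + 1) i with h | h | h
    · rw [if_pos (by omega), if_pos (by omega)]
      have := hf.adj (i - 1 - (t + 1)) (by omega)
      rw [show i - 1 - (t + 1) + 1 = i - 1 - t by omega] at this
      exact this.symm
    · rw [if_pos (by omega), if_neg (by omega), show i - 1 - t = 0 by omega, h]
      exact hadj
    · rw [if_neg (by omega), if_neg (by omega)]
      exact hf.adj t ht

/-- If the subgraph induced by `W` has no minor isomorphic to the complete graph on four vertices,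
then some vertex of `W` has at most two neighbours in `W`.

Otherwise take a longest path `f 0, …, f m` and a chord from `f 0` to `f i`, with `2 ≤ i` as small
as possible among all longest paths. Both `f 0` and `f (i - 1)` are first vertices of longest
paths, so that all their neighbours lie on the path, and each has a neighbour beyond `f i`. The
branch sets are four consecutive intervals of the path. -/
theorem exists_degree_le_two [Finite V] {W : Set V} (hW : W.Nonempty) (hno : ¬ HasK4Model G W) :
    ∃ v ∈ W, ∃ x y, ∀ u ∈ W, G.Adj v u → u = x ∨ u = y := by
  classical
  by_contra! hdeg
  let P : ℕ → Prop := fun m => ∃ f : ℕ → V, IsPathSeq G m f ∧ ∀ t ≤ m, f t ∈ W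
  have hbound : ∀ m, P m → m ≤ Nat.card V := by
    rintro m ⟨f, hf, -⟩
    have hinj : Function.Injective (fun t : Fin m => f t) := by
      intro s t hst
      by_contra hne
      rcases lt_or_gt_of_ne (Fin.val_ne_of_ne hne) with h | h
      · exact hf.ne _ _ h (by omega) hst
      · exact hf.ne _ _ h (by omega) hst.symm
    simpa using Nat.card_le_card_of_injective _ hinj
  have hP0 : P 0 := by
    obtain ⟨x, hx⟩ := hW
    exact ⟨fun _ => x, ⟨fun s t h1 h2 => by omega, fun t ht => by omega⟩, fun _ _ => hx⟩
  have hPm := Nat.findGreatest_spec (P := P) (Nat.zero_le (Nat.card V)) hP0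
  have hmax : ∀ n, P n → n ≤ Nat.findGreatest P (Nat.card V) :=
    fun n hn => Nat.le_findGreatest (hbound n hn) hn
  set m := Nat.findGreatest P (Nat.card V)
  have honpath : ∀ f : ℕ → V, IsPathSeq G m f → (∀ t ≤ m, f t ∈ W) → ∀ x ∈ W, G.Adj (f 0) x →
      ∃ t ≤ m, f t = x := by
    intro f hf hfW x hx hadj
    by_contra! hnot
    have hx0 : IsPathSeq G 0 (fun _ : ℕ => x) :=
      ⟨fun s t h1 h2 => by omega, fun t ht => by omega⟩
    have := hmax _ ⟨_, hx0.append hf (fun _ _ t ht => (hnot t ht).symm) hadj.symm, fun t ht => by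
      rw [appendSeq]
      split_ifs
      · exact hx
      · exact hfW _ (by omega)⟩
    omega
  have hpos : ∀ f : ℕ → V, IsPathSeq G m f → (∀ t ≤ m, f t ∈ W) → ∀ p q, p ≤ m → q ≤ m →
      ∃ t ≤ m, t ≠ 0 ∧ t ≠ p ∧ t ≠ q ∧ G.Adj (f 0) (f t) := by
    intro f hf hfW p q _ _
    obtain ⟨x, hx, hadj, hxp, hxq⟩ := hdeg (f 0) (hfW 0 (by omega)) (f p) (f q)
    obtain ⟨t, ht, rfl⟩ := honpath f hf hfW x hx hadj
    refine ⟨t, ht, ?_, ?_, ?_, hadj⟩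
    · rintro rfl; exact G.irrefl hadj
    · rintro rfl; exact hxp rfl
    · rintro rfl; exact hxq rfl
  have hm : 1 ≤ m := by
    obtain ⟨f, hf, hfW⟩ := hPm
    obtain ⟨t, ht, h0, -⟩ := hpos f hf hfW 0 0 (by omega) (by omega)
    omega
  let Q : ℕ → Prop := fun i => 2 ≤ i ∧ i ≤ m ∧ ∃ f : ℕ → V, IsPathSeq G m f ∧ (∀ t ≤ m, f t ∈ W) ∧
    G.Adj (f 0) (f i)
  have hQ : ∃ i, Q i := by
    obtain ⟨f, hf, hfW⟩ := hPm
    obtain ⟨t, ht, h0, h1, -, hadj⟩ := hpos f hf hfW 1 1 hm hm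
    exact ⟨t, by omega, ht, f, hf, hfW, hadj⟩
  have hmin := fun j => @Nat.find_min _ _ hQ j
  obtain ⟨hi2, him, f, hf, hfW, hadj⟩ := Nat.find_spec hQ
  set i := Nat.find hQ
  obtain ⟨j, hj, hj0, hj1, hji, hadj'⟩ := hpos f hf hfW 1 i hm him
  have hij : i < j := by
    by_contra h
    exact hmin j (by omega) ⟨by omega, hj, f, hf, hfW, hadj'⟩
  obtain ⟨a, ha, hia, hadja⟩ : ∃ a ≤ m, i < a ∧ G.Adj (f (i - 1)) (f a) := by
    have hg := hf.rotate him hadj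
    have hgW : ∀ t ≤ m, (fun t => if t < i then f (i - 1 - t) else f t) t ∈ W := by
      intro t ht
      dsimp only
      split_ifs
      · exact hfW _ (by omega)
      · exact hfW _ ht
    obtain ⟨t, ht, h0, h1, h2, hgadj⟩ := hpos _ hg hgW 1 i hm him
    have hit : i < t := by
      by_contra h
      exact hmin t (by omega) ⟨by omega, ht, _, hg, hgW, hgadj⟩
    refine ⟨t, ht, hit, ?_⟩
    simpa [show 0 < i by omega, show ¬ t < i by omega] using hgadj
  have hconn : ∀ a b, a ≤ b → b ≤ m → IsConn G (f '' Set.Icc a b) := fun a b hab hb =>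
    isConn_image_Icc hab fun t _ h2 => hf.adj t (by omega)
  have hsub : ∀ a b, b ≤ m → f '' Set.Icc a b ⊆ W := by
    rintro a b hb _ ⟨t, ⟨-, ht⟩, rfl⟩
    exact hfW t (by omega)
  have hdis : ∀ a b c d, b < c → d ≤ m → Disjoint (f '' Set.Icc a b) (f '' Set.Icc c d) := by
    intro a b c d hbc hd
    rw [Set.disjoint_left]
    rintro _ ⟨s, ⟨-, hs⟩, rfl⟩ ⟨t, ⟨ht1, ht2⟩, hst⟩
    exact hf.ne s t (by omega) (by omega) hst.symm
  have hedge : ∀ a b c d s t, a ≤ s → s ≤ b → c ≤ t → t ≤ d → G.Adj (f s) (f t) →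
      ∃ x ∈ f '' Set.Icc a b, ∃ y ∈ f '' Set.Icc c d, G.Adj x y :=
    fun a b c d s t h1 h2 h3 h4 h => ⟨_, ⟨s, ⟨h1, h2⟩, rfl⟩, _, ⟨t, ⟨h3, h4⟩, rfl⟩, h⟩
  have hstep : ∀ t, 1 ≤ t → t ≤ m → G.Adj (f (t - 1)) (f t) := by
    intro t h1 h2
    have := hf.adj (t - 1) (by omega)
    rwa [Nat.sub_add_cancel h1] at this
  -- both `j` and `a` belong to the last interval
  obtain ⟨e, he, hej, hea⟩ : ∃ e, i < e ∧ e ≤ j ∧ e ≤ a := ⟨min j a, by omega, by omega, by omega⟩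
  refine hno (hasK4Model_of_four (A := f '' Set.Icc 0 0) (B := f '' Set.Icc 1 (i - 1))
    (C := f '' Set.Icc i (e - 1)) (D := f '' Set.Icc e m) (hsub _ _ (by omega))
    (hsub _ _ (by omega)) (hsub _ _ (by omega)) (hsub _ _ le_rfl) (hconn _ _ (by omega) (by omega))
    (hconn _ _ (by omega) (by omega)) (hconn _ _ (by omega) (by omega))
    (hconn _ _ (by omega) (by omega)) (hdis _ _ _ _ (by omega) (by omega))
    (hdis _ _ _ _ (by omega) (by omega)) (hdis _ _ _ _ (by omega) (by omega))
    (hdis _ _ _ _ (by omega) (by omega)) (hdis _ _ _ _ (by omega) (by omega))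
    (hdis _ _ _ _ (by omega) (by omega)) ?_ ?_ ?_ ?_ ?_ ?_)
  · exact hedge _ _ _ _ 0 1 (by omega) (by omega) (by omega) (by omega) (hstep 1 le_rfl hm)
  · exact hedge _ _ _ _ 0 i (by omega) (by omega) (by omega) (by omega) hadj
  · exact hedge _ _ _ _ 0 j (by omega) (by omega) (by omega) (by omega) hadj'
  · exact hedge _ _ _ _ (i - 1) i (by omega) (by omega) (by omega) (by omega)
      (hstep i (by omega) him)
  · exact hedge _ _ _ _ (i - 1) a (by omega) (by omega) (by omega) (by omega) hadja
  · exact hedge _ _ _ _ (e - 1) e (by omega) (by omega) (by omega) (by omega)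
      (hstep e (by omega) (by omega))

end SimpleGraph

/-! ### Reductions for maximum independent sets -/

namespace SimpleGraph

variable {V : Type*} {G H : SimpleGraph V}

theorem isIndepSet_iff_forall_not_adj {S : Set V} :
    H.IsIndepSet S ↔ ∀ a ∈ S, ∀ b ∈ S, ¬ H.Adj a b := by
  refine ⟨fun h a ha b hb hab => h ha hb hab.ne hab, fun h a ha b hb _ => h a ha b hb⟩

variable [DecidableEq V]

/-- `S` is a maximum independent set of the subgraph of `H` induced by `W`. -/
structure IsMaxIndepIn (H : SimpleGraph V) (W S : Finset V) : Prop where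
  subset : S ⊆ W
  indep : ∀ a ∈ S, ∀ b ∈ S, ¬ H.Adj a b
  max : ∀ T ⊆ W, (∀ a ∈ T, ∀ b ∈ T, ¬ H.Adj a b) → T.card ≤ S.card

/-- `u` and `w` are all the neighbours of `v` in `W`, where missing neighbours are replaced by `v`
itself, `w` first. -/
structure IsNeighborPair (H : SimpleGraph V) (W : Finset V) (v u w : V) : Prop where
  mem_v : v ∈ W
  mem_u : u ∈ W
  mem_w : w ∈ W
  cover : ∀ x ∈ W, H.Adj v x → x = u ∨ x = w
  adj_u : u = v ∨ H.Adj v u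
  adj_w : w = v ∨ H.Adj v w
  eq_of_eq : u = w ∨ u = v → u = v ∧ w = v

theorem card_le_card_sdiff_add_one {T A : Finset V} (h : ∀ a ∈ T, ∀ b ∈ T, a ∈ A → b ∈ A → a = b) :
    T.card ≤ (T \ A).card + 1 := by
  rw [← Finset.card_sdiff_add_card_inter T A]
  refine Nat.add_le_add_left (Finset.card_le_one.2 fun a ha b hb => ?_) _
  rw [Finset.mem_inter] at ha hb
  exact h a ha.1 b hb.1 ha.2 hb.2

/-- A vertex whose neighbours form a clique belongs to a maximum independent set. -/
theorem IsMaxIndepIn.insert_of_adj {W S : Finset V} {v u w : V} (h : IsNeighborPair H W v u w)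
    (huw : H.Adj u w) (hS : IsMaxIndepIn H (W \ {v, u, w}) S) :
    IsMaxIndepIn H W (insert v S) := by
  have hSW : ∀ x ∈ S, x ∈ W ∧ x ≠ v ∧ x ≠ u ∧ x ≠ w := fun x hx => by
    simpa using hS.subset hx
  have hvS : ∀ x ∈ S, ¬ H.Adj v x := fun x hx hadj => by
    have := hSW x hx
    rcases h.cover x this.1 hadj with rfl | rfl
    · exact this.2.2.1 rfl
    · exact this.2.2.2 rfl
  refine ⟨?_, ?_, fun T hT hTi => ?_⟩
  · intro x hx
    rcases Finset.mem_insert.1 hx with rfl | hx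
    · exact h.mem_v
    · exact (hSW x hx).1
  · intro a ha b hb
    rcases Finset.mem_insert.1 ha with rfl | ha <;> rcases Finset.mem_insert.1 hb with rfl | hb
    · exact H.irrefl
    · exact hvS b hb
    · exact fun h => hvS a (by assumption) h.symm
    · exact hS.indep a ha b hb
  · rw [Finset.card_insert_of_notMem fun hv => (hSW v hv).2.1 rfl]
    refine (card_le_card_sdiff_add_one (A := {v, u, w}) fun a ha b hb ha' hb' => ?_).trans
      (Nat.add_le_add_right (hS.max _ (Finset.sdiff_subset_sdiff hT subset_rfl) fun a ha b hb =>
        hTi a (Finset.sdiff_subset ha) b (Finset.sdiff_subset hb)) 1)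
    by_contra hne
    have hab := hTi a ha b hb
    have hba := hTi b hb a ha
    have h1 := h.adj_u
    have h2 := h.adj_w
    have h3 := huw.symm
    have h4 := fun e : H.Adj v u => e.symm
    have h5 := fun e : H.Adj v w => e.symm
    simp only [Finset.mem_insert, Finset.mem_singleton] at ha' hb'
    rcases ha' with rfl | rfl | rfl <;> rcases hb' with rfl | rfl | rfl <;> grind

/-- The vertex fold: if `v` has the two nonadjacent neighbours `u` and `w`, then a maximum
independent set contains `u` and `w` or can be chosen to contain `v`. When `u = w = v`, this is the
removal of an isolated vertex. -/
theorem IsMaxIndepIn.unfold {W S : Finset V} {v u w : V} (h : IsNeighborPair H W v u w)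
    (huw : ¬ H.Adj u w) (hS : IsMaxIndepIn (H.mergeInto u w) (W \ {v, w}) S) :
    IsMaxIndepIn H W (if u ∈ S then insert w S else insert v S) := by
  have hSW : ∀ x ∈ S, x ∈ W ∧ x ≠ v ∧ x ≠ w := fun x hx => by
    simpa using hS.subset hx
  have hcase : (u = v ∧ w = v) ∨ (u ≠ v ∧ w ≠ v ∧ u ≠ w ∧ H.Adj v u ∧ H.Adj v w) := by
    by_cases huv : u = v
    · exact Or.inl (h.eq_of_eq (Or.inr huv))
    · have hvu := h.adj_u.resolve_left huv
      have hwv : w ≠ v := by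
        rintro rfl
        exact huw hvu.symm
      exact Or.inr ⟨huv, hwv, fun e => huv (h.eq_of_eq (Or.inl e)).1, hvu,
        h.adj_w.resolve_left hwv⟩
  have hSi : ∀ a ∈ S, ∀ b ∈ S, ¬ H.Adj a b := fun a ha b hb hab =>
    hS.indep a ha b hb ((mergeInto_adj huw).2 (Or.inl hab))
  have hins : ∀ z, (∀ x ∈ S, ¬ H.Adj z x) → ∀ a ∈ insert z S, ∀ b ∈ insert z S, ¬ H.Adj a b := by
    intro z hz a ha b hb
    rcases Finset.mem_insert.1 ha with rfl | ha <;> rcases Finset.mem_insert.1 hb with rfl | hb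
    · exact H.irrefl
    · exact hz b hb
    · exact fun h => hz a (by assumption) h.symm
    · exact hSi a ha b hb
  have hcard : (if u ∈ S then insert w S else insert v S).card = S.card + 1 := by
    split_ifs
    · exact Finset.card_insert_of_notMem fun hw => (hSW w hw).2.2 rfl
    · exact Finset.card_insert_of_notMem fun hv => (hSW v hv).2.1 rfl
  refine ⟨?_, ?_, fun T hT hTi => ?_⟩
  · have hSW' : S ⊆ W := fun x hx => (hSW x hx).1
    split_ifs
    · exact Finset.insert_subset h.mem_w hSW'
    · exact Finset.insert_subset h.mem_v hSW'
  · split_ifs with hu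
    · exact hins w fun x hx hwx =>
        hS.indep u hu x hx ((mergeInto_adj huw).2 (Or.inr (Or.inl ⟨rfl, hwx⟩)))
    · refine hins v fun x hx hvx => ?_
      rcases h.cover x (hSW x hx).1 hvx with rfl | rfl
      · exact hu hx
      · exact (hSW x hx).2.2 rfl
  · rw [hcard]
    by_cases huwT : u ∈ T ∧ w ∈ T
    · -- `v` is not in `T` unless it equals `w`, and `u` represents both `u` and `w` after the fold
      refine (card_le_card_sdiff_add_one (A := {v, w}) fun a ha b hb ha' hb' => ?_).trans
        (Nat.add_le_add_right (hS.max _ (Finset.sdiff_subset_sdiff hT subset_rfl)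
          fun a ha b hb hab => ?_) 1)
      · rcases hcase with ⟨rfl, rfl⟩ | ⟨-, -, -, hvu, -⟩
        · simp only [Finset.mem_insert, Finset.mem_singleton, or_self] at ha' hb'
          rw [ha', hb']
        · have hvT : v ∉ T := fun hv => hTi v hv u huwT.1 hvu
          simp only [Finset.mem_insert, Finset.mem_singleton] at ha' hb'
          grind
      · have ha' := (Finset.mem_sdiff.1 ha).1
        have hb' := (Finset.mem_sdiff.1 hb).1
        rcases (mergeInto_adj huw).1 hab with h | ⟨-, h⟩ | ⟨-, h⟩
        · exact hTi a ha' b hb' h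
        · exact hTi w huwT.2 b hb' h
        · exact hTi w huwT.2 a ha' h
    · refine (card_le_card_sdiff_add_one (A := {v, u, w}) fun a ha b hb ha' hb' => ?_).trans
        (Nat.add_le_add_right (hS.max _ (fun x hx => ?_) fun a ha b hb hab => ?_) 1)
      · simp only [Finset.mem_insert, Finset.mem_singleton] at ha' hb'
        by_contra hne
        have hab := hTi a ha b hb
        have hba := hTi b hb a ha
        rcases hcase with ⟨rfl, rfl⟩ | ⟨-, -, -, hvu, hvw⟩
        · grind
        · have h4 := hvu.symm
          have h5 := hvw.symm
          rcases ha' with rfl | rfl | rfl <;> rcases hb' with rfl | rfl | rfl <;> grind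
      · have := Finset.mem_sdiff.1 hx
        simp only [Finset.mem_insert, Finset.mem_singleton, Finset.mem_sdiff] at this ⊢
        exact ⟨hT this.1, by tauto⟩
      · simp only [Finset.mem_insert, Finset.mem_singleton, Finset.mem_sdiff] at ha hb
        rcases (mergeInto_adj huw).1 hab with h | ⟨h, -⟩ | ⟨h, -⟩
        · exact hTi a ha.1 b hb.1 h
        · exact ha.2 (Or.inr (Or.inl h))
        · exact hb.2 (Or.inr (Or.inl h))

/-- Undo a list of reductions, the latest first. An entry `(v, u, w)` records a fold of `v` onto `u`
and `w`; an entry `(v, v, v)` records that `v` was selected. -/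
def unwind : List (V × V × V) → Finset V → Finset V
  | [], S => S
  | (v, u, w) :: L, S => unwind L (if u ∈ S then insert w S else insert v S)

/-- The state of the reduction of `G`: the current graph is `H` on the vertices `W`, and `L` lists
the reductions made so far, the latest first. The minor is excluded so that a further reduction is
possible as long as `W` is nonempty. -/
structure IsReduction [Fintype V] (G H : SimpleGraph V) (W : Finset V) (L : List (V × V × V)) : Prop where
  noK4 : ¬ HasK4Model H W
  unwind : ∀ S, IsMaxIndepIn H W S → IsMaxIndepIn G Finset.univ (unwind L S)

theorem IsReduction.select [Fintype V] {W : Finset V} {L : List (V × V × V)} {v u w : V}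
    (hR : IsReduction G H W L) (h : IsNeighborPair H W v u w) (huw : H.Adj u w) :
    IsReduction G H (W \ {v, u, w}) ((v, v, v) :: L) where
  noK4 hK := hR.noK4 (hK.mono (by simp))
  unwind S hS := by
    have hv : v ∉ S := fun hv => by simpa using hS.subset hv
    rw [SimpleGraph.unwind, if_neg hv]
    exact hR.unwind _ (hS.insert_of_adj h huw)

theorem IsReduction.fold [Fintype V] {W : Finset V} {L : List (V × V × V)} {v u w : V}
    (hR : IsReduction G H W L) (h : IsNeighborPair H W v u w) (huw : ¬ H.Adj u w) :
    IsReduction G (H.mergeInto u w) (W \ {v, w}) ((v, u, w) :: L) where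
  noK4 hK := by
    refine hR.noK4 (HasK4Model.of_mergeInto huw h.mem_v h.mem_w ?_ (by simpa using hK))
    by_cases huv : u = v
    · exact Or.inr huv
    · have hvu := h.adj_u.resolve_left huv
      exact Or.inl ⟨hvu, h.adj_w.resolve_left (by rintro rfl; exact huw hvu.symm)⟩
  unwind S hS := by
    rw [SimpleGraph.unwind]
    exact hR.unwind _ (hS.unfold h huw)

end SimpleGraph

/-! ### Programs with bounded loops -/

namespace RAM

/-- Programs whose only loops are `each i B`: run `B` once for each value `0, …, n - 1` of the
register `i`, where `n` is the content of register `0`. -/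
inductive Code where
  | skip
  | instr (i : Instr)
  | seq (P Q : Code)
  | ite (x : ℕ) (P Q : Code)
  | each (i : ℕ) (B : Code)

/-- The register that an instruction writes to, as a list with at most one entry. -/
def Instr.target : Instr → List ℕ
  | .const x _ | .move x _ | .add x _ _ | .sub x _ _ | .load x _ _ => [x]
  | .store _ _ _ => []

/-- The array that an instruction writes to, as a list with at most one entry. -/
def Instr.targetArr : Instr → List ℕ
  | .store a _ _ => [a]
  | _ => []

namespace Code

/-- Translation into the machine language. Register `1` is expected to hold the constant `1`, and
register `2` holds the number of remaining iterations when a loop is tested; it is recomputed from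
the index register after each iteration, so that all loops can share it. -/
def compile : Code → Prog
  | skip => .instr (.move 0 0)
  | instr i => .instr i
  | seq P Q => .seq P.compile Q.compile
  | ite x P Q => .ite x P.compile Q.compile
  | each i B => .seq (.instr (.const i 0)) (.seq (.instr (.sub 2 0 i))
      (.loop 2 (.seq B.compile (.seq (.instr (.add i i 1)) (.instr (.sub 2 0 i))))))

/-- The effect of a program on the memory. -/
def eval : Code → State → State
  | skip, s => s
  | instr i, s => i.apply s
  | seq P Q, s => Q.eval (P.eval s)
  | ite x P Q, s => if s.reg x = 0 then Q.eval s else P.eval s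
  | each i B, s =>
    (fun s => (Instr.sub 2 0 i).apply ((Instr.add i i 1).apply (B.eval s)))^[s.reg 0]
      ((Instr.sub 2 0 i).apply ((Instr.const i 0).apply s))

/-- The registers that a program may write to. -/
def writes : Code → List ℕ
  | skip => []
  | instr i => i.target
  | seq P Q => P.writes ++ Q.writes
  | ite _ P Q => P.writes ++ Q.writes
  | each i B => i :: 2 :: B.writes

/-- The arrays that a program may write to. -/
def writesArr : Code → List ℕ
  | skip => []
  | instr i => i.targetArr
  | seq P Q => P.writesArr ++ Q.writesArr
  | ite _ P Q => P.writesArr ++ Q.writesArr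
  | each _ B => B.writesArr

/-- The registers `0` and `1` are not written to explicitly, and the index register of a loop is written to
neither by the body nor by the loop test. -/
def Valid : Code → Prop
  | skip => True
  | instr i => 0 ∉ i.target ∧ 1 ∉ i.target
  | seq P Q => P.Valid ∧ Q.Valid
  | ite _ P Q => P.Valid ∧ Q.Valid
  | each i B => B.Valid ∧ i ∉ B.writes ∧ 2 < i

/-- A polynomial bound for the running time in terms of the content of register `0`. -/
noncomputable def time : Code → Polynomial ℕ
  | skip => 1
  | instr _ => 1
  | seq P Q => P.time + Q.time
  | ite _ P Q => 1 + (P.time + Q.time)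
  | each _ B => 3 + Polynomial.X * (B.time + 3)

end Code

theorem Instr.apply_reg {i : Instr} {x : ℕ} (hx : x ∉ i.target) (s : State) :
    (i.apply s).reg x = s.reg x := by
  cases i <;> simp_all [Instr.target, Instr.apply, State.setReg, State.setArr]

theorem Instr.apply_arr {i : Instr} {a : ℕ} (ha : a ∉ i.targetArr) (s : State) :
    (i.apply s).arr a = s.arr a := by
  cases i <;> simp_all [Instr.targetArr, Instr.apply, State.setReg, State.setArr]

namespace Code

theorem eval_reg {C : Code} {x : ℕ} (hx : x ∉ C.writes) (s : State) :
    (C.eval s).reg x = s.reg x := by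
  induction C generalizing s with
  | skip => rfl
  | instr i => exact Instr.apply_reg hx s
  | seq P Q ihP ihQ =>
    simp only [writes, List.mem_append, not_or] at hx
    rw [eval, ihQ hx.2, ihP hx.1]
  | ite y P Q ihP ihQ =>
    simp only [writes, List.mem_append, not_or] at hx
    rw [eval]
    split_ifs
    · exact ihQ hx.2 s
    · exact ihP hx.1 s
  | each i B ih =>
    simp only [writes, List.mem_cons, not_or] at hx
    have hstep : ∀ s : State, ((Instr.sub 2 0 i).apply ((Instr.add i i 1).apply
        (B.eval s))).reg x = s.reg x := fun s => by
      rw [Instr.apply_reg (by simpa [Instr.target] using hx.2.1),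
        Instr.apply_reg (by simpa [Instr.target] using hx.1), ih hx.2.2]
    rw [eval]
    generalize s.reg 0 = n
    induction n with
    | zero =>
      rw [Function.iterate_zero_apply, Instr.apply_reg (by simpa [Instr.target] using hx.2.1),
        Instr.apply_reg (by simpa [Instr.target] using hx.1)]
    | succ n ihn => rw [Function.iterate_succ_apply', hstep, ihn]

theorem eval_arr {C : Code} {a : ℕ} (ha : a ∉ C.writesArr) (s : State) :
    (C.eval s).arr a = s.arr a := by
  induction C generalizing s with
  | skip => rfl
  | instr i => exact Instr.apply_arr ha s
  | seq P Q ihP ihQ =>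
    simp only [writesArr, List.mem_append, not_or] at ha
    rw [eval, ihQ ha.2, ihP ha.1]
  | ite y P Q ihP ihQ =>
    simp only [writesArr, List.mem_append, not_or] at ha
    rw [eval]
    split_ifs
    · exact ihQ ha.2 s
    · exact ihP ha.1 s
  | each i B ih =>
    have hstep : ∀ s : State, ((Instr.sub 2 0 i).apply ((Instr.add i i 1).apply
        (B.eval s))).arr a = s.arr a := fun s => ih ha s
    rw [eval]
    generalize s.reg 0 = n
    induction n with
    | zero => rfl
    | succ n ihn => rw [Function.iterate_succ_apply', hstep, ihn]

theorem Valid.reserved {C : Code} (h : C.Valid) : 0 ∉ C.writes ∧ 1 ∉ C.writes := by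
  induction C with
  | skip => simp [writes]
  | instr i => exact h
  | seq P Q ihP ihQ => simp [writes, ihP h.1, ihQ h.2]
  | ite x P Q ihP ihQ => simp [writes, ihP h.1, ihQ h.2]
  | each i B ih =>
    have h2 := h.2.2
    simp only [writes, List.mem_cons, ih h.1, or_false]
    omega

/-- The loop rule: an invariant that does not depend on the index register and the test register
holds after the loop. -/
theorem eval_each_induction {i : ℕ} {B : Code} (hB : (each i B).Valid) {I : ℕ → State → Prop}
    {s : State} (h1 : s.reg 1 = 1)
    (hreg : ∀ t s x v, (x = i ∨ x = 2) → I t s → I t (s.setReg x v)) (h0 : I 0 s)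
    (hstep : ∀ t < s.reg 0, ∀ s', s'.reg 0 = s.reg 0 → s'.reg 1 = 1 → s'.reg i = t → I t s' →
      I (t + 1) (B.eval s')) :
    I (s.reg 0) ((each i B).eval s) := by
  obtain ⟨hV, hiB, hi⟩ := hB
  obtain ⟨hB0, hB1⟩ := hV.reserved
  rw [eval]
  have key : ∀ t ≤ s.reg 0, ∀ s', s' = (fun s => (Instr.sub 2 0 i).apply
      ((Instr.add i i 1).apply (B.eval s)))^[t]
      ((Instr.sub 2 0 i).apply ((Instr.const i 0).apply s)) →
      s'.reg 0 = s.reg 0 ∧ s'.reg 1 = 1 ∧ s'.reg i = t ∧ I t s' := by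
    intro t
    induction t with
    | zero =>
      rintro - s' rfl
      have hi0 : 0 ≠ i := by omega
      have hi1 : 1 ≠ i := by omega
      have hi2 : i ≠ 2 := by omega
      refine ⟨?_, ?_, ?_, hreg _ _ _ _ (Or.inr rfl) (hreg _ _ _ _ (Or.inl rfl) h0)⟩ <;>
        simp [Instr.apply, State.setReg, hi0, hi1, hi2, h1]
    | succ t ih =>
      rintro ht s' rfl
      obtain ⟨e0, e1, ei, hI⟩ := ih (by omega) _ rfl
      rw [Function.iterate_succ_apply']
      have hI' := hstep t (by omega) _ e0 e1 ei hI
      rw [← eval_reg hB0] at e0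
      rw [← eval_reg hB1] at e1
      rw [← eval_reg hiB] at ei
      generalize B.eval _ = s' at e0 e1 ei hI' ⊢
      have hi0 : 0 ≠ i := by omega
      have hi1 : 1 ≠ i := by omega
      have hi2 : i ≠ 2 := by omega
      refine ⟨?_, ?_, ?_, hreg _ _ _ _ (Or.inr rfl) (hreg _ _ _ _ (Or.inl rfl) hI')⟩ <;>
        simp [Instr.apply, State.setReg, hi0, hi1, hi2, e0, e1, ei]
  exact (key _ le_rfl _ rfl).2.2.2

/-- The compiled program has the effect `eval` and runs within the polynomial bound `time`. -/
theorem exec_compile {C : Code} (hC : C.Valid) {s : State} (h1 : s.reg 1 = 1) :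
    ∃ t ≤ C.time.eval (s.reg 0), Exec C.compile s t (C.eval s) := by
  induction C generalizing s with
  | skip =>
    refine ⟨1, by simp [time], ?_⟩
    have h := Exec.instr (Instr.move 0 0) s
    have he : (Instr.move 0 0).apply s = s := by
      simp [Instr.apply, State.setReg]
    rwa [he] at h
  | instr i => exact ⟨1, by simp [time], Exec.instr i s⟩
  | seq P Q ihP ihQ =>
    obtain ⟨t, ht, hP⟩ := ihP hC.1 h1
    obtain ⟨t', ht', hQ⟩ := ihQ hC.2 (s := P.eval s) (by rw [eval_reg hC.1.reserved.2, h1])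
    rw [eval_reg hC.1.reserved.1] at ht'
    exact ⟨t + t', by simpa [time] using Nat.add_le_add ht ht', hP.seq hQ⟩
  | ite x P Q ihP ihQ =>
    obtain ⟨t, ht, hP⟩ := ihP hC.1 h1
    obtain ⟨t', ht', hQ⟩ := ihQ hC.2 h1
    rw [eval, compile]
    split_ifs with hx
    · exact ⟨1 + t', by simp only [time, Polynomial.eval_add, Polynomial.eval_one]; omega,
        .iteFalse hx hQ⟩
    · exact ⟨1 + t, by simp only [time, Polynomial.eval_add, Polynomial.eval_one]; omega,
        .iteTrue hx hP⟩
  | each i B ih =>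
    obtain ⟨hV, hiB, hi⟩ := hC
    obtain ⟨hB0, hB1⟩ := hV.reserved
    have hi0 : 0 ≠ i := by omega
    have hi1 : 1 ≠ i := by omega
    have hi2 : i ≠ 2 := by omega
    -- the loop, started `m` iterations before its end
    have hloop : ∀ m, ∀ s' : State, s'.reg 0 = s.reg 0 → s'.reg 1 = 1 → s'.reg 2 = m →
        s'.reg i + m = s.reg 0 →
        ∃ t ≤ 1 + m * (B.time.eval (s.reg 0) + 3), Exec (.loop 2 (.seq B.compile
          (.seq (.instr (.add i i 1)) (.instr (.sub 2 0 i))))) s' t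
          ((fun s => (Instr.sub 2 0 i).apply ((Instr.add i i 1).apply (B.eval s)))^[m] s') := by
      intro m
      induction m with
      | zero => exact fun s' _ _ h2 _ => ⟨1, by simp, .loopStop h2⟩
      | succ m ihm =>
        intro s' e0 e1 e2 ei
        obtain ⟨t, ht, hexec⟩ := ih hV e1
        rw [e0] at ht
        obtain ⟨t', ht', hexec'⟩ := ihm ((Instr.sub 2 0 i).apply ((Instr.add i i 1).apply
          (B.eval s')))
          (by simp [Instr.apply, State.setReg, hi0, eval_reg hB0, e0])
          (by simp [Instr.apply, State.setReg, hi1, eval_reg hB1, e1])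
          (by simp [Instr.apply, State.setReg, hi0, eval_reg hB0, eval_reg hB1, eval_reg hiB, e0,
                e1]; omega)
          (by simp [Instr.apply, State.setReg, hi2, eval_reg hB1, eval_reg hiB, e1]; omega)
        refine ⟨1 + (t + (1 + 1)) + t', ?_, .loopStep (by omega)
          (hexec.seq ((Exec.instr _ _).seq (Exec.instr _ _))) hexec'⟩
        rw [Nat.add_mul]
        omega
    obtain ⟨t, ht, hexec⟩ := hloop (s.reg 0) ((Instr.sub 2 0 i).apply ((Instr.const i 0).apply s))
      (by simp [Instr.apply, State.setReg, hi0]) (by simp [Instr.apply, State.setReg, hi1, h1])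
      (by simp [Instr.apply, State.setReg, hi0]) (by simp [Instr.apply, State.setReg, hi2])
    refine ⟨1 + (1 + t), ?_, (Exec.instr _ _).seq ((Exec.instr _ _).seq hexec)⟩
    have h3 : Polynomial.eval (s.reg 0) (3 : Polynomial ℕ) = 3 := Polynomial.eval_natCast (n := 3)
    simp only [time, Polynomial.eval_add, Polynomial.eval_mul, Polynomial.eval_X, h3]
    omega

end Code

end RAM

/-! ### The program -/

namespace RAM

open SimpleGraph

namespace Code

/-- Sequential composition of a list of programs. -/
def block : List Code → Code
  | [] => skip
  | C :: L => seq C (block L)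

/-- Read the adjacency matrix at row `reg a` and column `reg x` into register `d`. The row offsets
are stored in array `2`. -/
def getAdj (d a x : ℕ) : Code := block [instr (.load 4 2 a), instr (.add 4 4 x), instr (.load d 0 4)]

/-- Set the entry of the adjacency matrix at row `reg a` and column `reg x` to `1`. -/
def setAdj (a x : ℕ) : Code := block [instr (.load 4 2 a), instr (.add 4 4 x), instr (.store 0 4 1)]

/-- Fill array `2` with the multiples of `n`. -/
def initRows : Code := each 7 (block [instr (.store 2 7 4), instr (.add 4 4 0)])

/-- Delete the vertex `reg x`: array `3` holds `1` for deleted and `0` for remaining vertices. -/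
def kill (x : ℕ) : Code := instr (.store 3 x 1)

/-- Push a triple on the stack, which occupies the arrays `4`, `5`, `6` and has its height in
register `3`. -/
def push (a b c : ℕ) : Code :=
  block [instr (.store 4 3 a), instr (.store 5 3 b), instr (.store 6 3 c), instr (.add 3 3 1)]

/-- The loop body of `scan`. -/
def scanBody : Code :=
  block [instr (.load 8 3 7), ite 8 skip (block [getAdj 8 6 7,
    ite 8 (block [instr (.add 9 9 1), instr (.move 11 10), instr (.move 10 7)]) skip])]

/-- Count the neighbours of the vertex `reg 6` in register `9`, and store the last two of them in
the registers `10` and `11`, which initially hold the vertex itself. -/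
def scan : Code :=
  block [instr (.const 9 0), instr (.move 10 6), instr (.move 11 6), each 7 scanBody]

/-- The loop body of `merge`. -/
def mergeBody : Code :=
  block [getAdj 8 11 7, ite 8 (block [setAdj 10 7, setAdj 7 10]) skip]

/-- Add the neighbours of `reg 11` to those of `reg 10`. -/
def merge : Code := each 7 mergeBody

/-- Reduce the graph at the vertex `reg 6` if it is not deleted and has at most two neighbours. With
fewer than two neighbours, `reg 11` is the vertex itself, so that the test for an edge between
`reg 10` and `reg 11` selects a vertex of degree one and folds an isolated vertex onto itself. -/
def visit : Code :=
  block [instr (.load 8 3 6), ite 8 skip (block [scan, instr (.const 12 3), instr (.sub 12 12 9),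
    ite 12 (block [getAdj 8 10 11,
      ite 8 (block [kill 6, kill 10, kill 11, push 6 6 6])
        (block [merge, kill 6, kill 11, push 6 10 11])]) skip])]

/-- Visit all vertices, `n` times. Every round deletes a vertex as long as one remains. -/
def reduce : Code := each 5 (each 6 visit)

/-- The loop body of `unwindAll`. -/
def unwindBody : Code :=
  block [instr (.sub 4 3 5), ite 4 (block [instr (.sub 4 4 1), instr (.load 6 4 4),
    instr (.load 10 5 4), instr (.load 11 6 4), instr (.load 8 1 10),
    ite 8 (instr (.store 1 11 1)) (instr (.store 1 6 1))]) skip]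

/-- Read the stack from the top, building an independent set in array `1`. The stack has at most
`n` entries. -/
def unwindAll : Code := each 5 unwindBody

/-- Compute a maximum independent set. -/
def maxIndep : Code := block [initRows, reduce, unwindAll]

/-- Replace the set in array `1` by its complement. -/
def complement : Code :=
  each 5 (block [instr (.load 8 1 5), instr (.sub 8 1 8), instr (.store 1 5 8)])

theorem eval_block_cons (C : Code) (L : List Code) (s : State) :
    (block (C :: L)).eval s = (block L).eval (C.eval s) := rfl

theorem eval_block_nil (s : State) : (block []).eval s = s := rfl

theorem eval_instr (i : Instr) (s : State) : (instr i).eval s = i.apply s := rfl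

theorem eval_skip (s : State) : skip.eval s = s := rfl

theorem eval_ite (x : ℕ) (P Q : Code) (s : State) :
    (ite x P Q).eval s = if s.reg x = 0 then Q.eval s else P.eval s := rfl

end Code

/-- The stack stored in the arrays `4`, `5`, `6` of the memory `a`; the head of the list is the
top. -/
def StackOf {n : ℕ} (a : ℕ → ℕ → ℕ) : List (Fin n × Fin n × Fin n) → Prop
  | [] => True
  | (v, u, w) :: L => a 4 L.length = v ∧ a 5 L.length = u ∧ a 6 L.length = w ∧ StackOf a L

theorem StackOf.congr {n : ℕ} {a a' : ℕ → ℕ → ℕ} {L : List (Fin n × Fin n × Fin n)}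
    (h : StackOf a L) (h4 : ∀ j < L.length, a' 4 j = a 4 j) (h5 : ∀ j < L.length, a' 5 j = a 5 j)
    (h6 : ∀ j < L.length, a' 6 j = a 6 j) : StackOf a' L := by
  induction L with
  | nil => trivial
  | cons x L ih =>
    obtain ⟨v, u, w⟩ := x
    obtain ⟨e4, e5, e6, h⟩ := h
    simp only [List.length_cons] at h4 h5 h6
    exact ⟨by rw [h4 _ (by omega), e4], by rw [h5 _ (by omega), e5], by rw [h6 _ (by omega), e6],
      ih h (fun j hj => h4 j (by omega)) (fun j hj => h5 j (by omega))
        (fun j hj => h6 j (by omega))⟩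

theorem StackOf.drop {n : ℕ} {a : ℕ → ℕ → ℕ} {L : List (Fin n × Fin n × Fin n)}
    (h : StackOf a L) (t : ℕ) : StackOf a (L.drop t) := by
  induction t generalizing L with
  | zero => exact h
  | succ t ih =>
    cases L with
    | nil => trivial
    | cons x L => exact ih h.2.2.2

open Classical in
/-- The memory `s` represents the graph `H` on the vertices `W` and the stack `L`; the output array
is still empty. Entries of the adjacency matrix at deleted vertices are kept. -/
structure Encodes {n : ℕ} (s : State) (H : SimpleGraph (Fin n)) (W : Finset (Fin n))
    (L : List (Fin n × Fin n × Fin n)) : Prop where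
  size : s.reg 0 = n
  one : s.reg 1 = 1
  row : ∀ i : Fin n, s.arr 2 i = i * n
  adj : ∀ i j : Fin n, s.arr 0 (i * n + j) = if H.Adj i j then 1 else 0
  dead : ∀ i : Fin n, s.arr 3 i = if i ∈ W then 0 else 1
  top : s.reg 3 = L.length
  stack : StackOf s.arr L
  out : ∀ i : Fin n, s.arr 1 i = 0

section

variable {n : ℕ} {s : State} {H : SimpleGraph (Fin n)} {W : Finset (Fin n)}
  {L : List (Fin n × Fin n × Fin n)}

theorem Encodes.congr {s' : State} (h : Encodes s H W L) (h0 : s'.reg 0 = s.reg 0)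
    (h1 : s'.reg 1 = s.reg 1) (h3 : s'.reg 3 = s.reg 3) (ha : s'.arr = s.arr) :
    Encodes s' H W L :=
  ⟨h0.trans h.size, h1.trans h.one, ha ▸ h.row, ha ▸ h.adj, ha ▸ h.dead, h3.trans h.top,
    ha ▸ h.stack, ha ▸ h.out⟩

theorem Encodes.eval {C : Code} (h : Encodes s H W L) (h0 : 0 ∉ C.writes) (h1 : 1 ∉ C.writes)
    (h3 : 3 ∉ C.writes) (ha : C.writesArr = []) : Encodes (C.eval s) H W L :=
  h.congr (Code.eval_reg h0 s) (Code.eval_reg h1 s) (Code.eval_reg h3 s)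
    (funext fun a => Code.eval_arr (by simp [ha]) s)

/-- Entries of a matrix stored row by row have distinct addresses. -/
theorem rowMajor_inj {i j i' j' : Fin n} :
    (i : ℕ) * n + j = i' * n + j' ↔ i = i' ∧ j = j' := by
  constructor
  · intro h
    have hn : 0 < n := i.pos
    have h1 : ((i : ℕ) * n + j) / n = i := by
      rw [Nat.mul_comm, Nat.mul_add_div hn, Nat.div_eq_of_lt j.2, Nat.add_zero]
    have h2 : ((i' : ℕ) * n + j') / n = i' := by
      rw [Nat.mul_comm, Nat.mul_add_div hn, Nat.div_eq_of_lt j'.2, Nat.add_zero]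
    have h3 : (i : ℕ) = i' := by rw [← h1, h, h2]
    refine ⟨Fin.ext h3, Fin.ext ?_⟩
    rw [h3] at h
    omega
  · rintro ⟨rfl, rfl⟩
    rfl

open Classical in
theorem Encodes.getAdj_eval (h : Encodes s H W L) {d a x : ℕ} (hx : x ≠ 4) {i j : Fin n}
    (hi : s.reg a = i) (hj : s.reg x = j) :
    (Code.getAdj d a x).eval s =
      (s.setReg 4 (i * n + j)).setReg d (if H.Adj i j then 1 else 0) := by
  simp [Code.getAdj, Code.eval_block_cons, Code.eval_block_nil, Code.eval_instr, Instr.apply,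
    State.setReg, hx, hi, hj, h.row, h.adj]

theorem setAdj_eval (h1 : s.reg 1 = 1) (hrow : ∀ i : Fin n, s.arr 2 i = i * n) {a x : ℕ}
    (hx : x ≠ 4) {i j : Fin n} (hi : s.reg a = i) (hj : s.reg x = j) :
    (Code.setAdj a x).eval s = (s.setReg 4 (i * n + j)).setArr 0 (i * n + j) 1 := by
  simp [Code.setAdj, Code.eval_block_cons, Code.eval_block_nil, Code.eval_instr, Instr.apply,
    State.setReg, State.setArr, hx, hi, hj, hrow, h1]

theorem Encodes.kill (h : Encodes s H W L) {x : ℕ} {v : Fin n} (hv : s.reg x = v) :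
    Encodes ((Code.kill x).eval s) H (W.erase v) L := by
  have e : (Code.kill x).eval s = s.setArr 3 v 1 := by
    simp [Code.kill, Code.eval_instr, Instr.apply, hv, h.one]
  rw [e]
  refine ⟨h.size, h.one, h.row, h.adj, fun i => ?_, h.top,
    h.stack.congr (fun _ _ => rfl) (fun _ _ => rfl) (fun _ _ => rfl), h.out⟩
  simp only [State.setArr, Function.update_self, Function.update_apply, Finset.mem_erase,
    Fin.val_inj, h.dead]
  by_cases hi : i = v <;> simp [hi]

theorem Encodes.push (h : Encodes s H W L) {a b c : ℕ} {v u w : Fin n} (hv : s.reg a = v)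
    (hu : s.reg b = u) (hw : s.reg c = w) :
    Encodes ((Code.push a b c).eval s) H W ((v, u, w) :: L) := by
  have e : (Code.push a b c).eval s = (((s.setArr 4 L.length v).setArr 5 L.length u).setArr 6
      L.length w).setReg 3 (L.length + 1) := by
    simp [Code.push, Code.eval_block_cons, Code.eval_block_nil, Code.eval_instr, Instr.apply,
      State.setArr, h.top, hv, hu, hw, h.one]
  rw [e]
  refine ⟨h.size, h.one, h.row, h.adj, h.dead, by simp [State.setReg], ?_, h.out⟩
  refine ⟨by simp [State.setReg, State.setArr], by simp [State.setReg, State.setArr],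
    by simp [State.setReg, State.setArr], h.stack.congr ?_ ?_ ?_⟩ <;>
  · intro j hj
    simp [State.setReg, State.setArr, hj.ne]

/-- The contents `deg`, `a`, `b` of the registers `9`, `10`, `11` after scanning the set `N` of
neighbours of `v`. -/
structure IsScan (v : Fin n) (N : Finset (Fin n)) (deg a b : ℕ) : Prop where
  deg_eq : deg = N.card
  zero : N.card = 0 → a = v ∧ b = v
  one : N.card = 1 → ∃ u ∈ N, a = u ∧ b = v
  two : N.card = 2 → ∃ u ∈ N, ∃ w ∈ N, u ≠ w ∧ a = u ∧ b = w

theorem IsScan.insert {v x : Fin n} {N : Finset (Fin n)} {deg a b : ℕ} (h : IsScan v N deg a b)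
    (hx : x ∉ N) : IsScan v (insert x N) (deg + 1) x a := by
  have hc := Finset.card_insert_of_notMem hx
  refine ⟨by rw [hc, h.deg_eq], fun h0 => by omega, fun h1 => ?_, fun h2 => ?_⟩
  · exact ⟨x, by simp, rfl, (h.zero (by omega)).1⟩
  · obtain ⟨u, hu, rfl, -⟩ := h.one (by omega)
    exact ⟨x, by simp, u, by simp [hu], by rintro rfl; exact hx hu, rfl, rfl⟩

open Classical in
theorem Encodes.scan (h : Encodes s H W L) {v : Fin n} (hv : s.reg 6 = v) :
    IsScan v (W.filter (H.Adj v)) ((Code.scan.eval s).reg 9) ((Code.scan.eval s).reg 10)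
      ((Code.scan.eval s).reg 11) := by
  let s₁ : State := ((s.setReg 9 0).setReg 10 v).setReg 11 v
  have hs₁ : Code.scan.eval s = (Code.each 7 Code.scanBody).eval s₁ := by
    simp [Code.scan, Code.eval_block_cons, Code.eval_block_nil, Code.eval_instr, Instr.apply,
      State.setReg, hv, s₁]
  have h₁ : Encodes s₁ H W L := h.congr rfl rfl rfl rfl
  have key := Code.eval_each_induction (i := 7) (B := Code.scanBody)
    (I := fun t s' => Encodes s' H W L ∧ s'.reg 6 = v ∧
      IsScan v (W.filter fun x => H.Adj v x ∧ (x : ℕ) < t) (s'.reg 9) (s'.reg 10) (s'.reg 11))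
    (by simp [Code.Valid, Code.scanBody, Code.block, Code.getAdj, Code.writes, Instr.target])
    h₁.one
    (by
      rintro t s' x v' hx ⟨e1, e2, e3⟩
      have hne : 0 ≠ x ∧ 1 ≠ x ∧ 3 ≠ x ∧ 6 ≠ x ∧ 9 ≠ x ∧ 10 ≠ x ∧ 11 ≠ x := by omega
      obtain ⟨n0, n1, n3, n6, n9, n10, n11⟩ := hne
      refine ⟨e1.congr ?_ ?_ ?_ rfl, ?_, ?_⟩ <;> simp [State.setReg, *])
    ⟨h₁, by simp [s₁, State.setReg, hv], by
      constructor <;> simp [s₁, State.setReg]⟩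
    (by
      rintro t ht s' - - h7 ⟨e1, e2, e3⟩
      rw [h₁.size] at ht
      obtain ⟨x, rfl⟩ : ∃ x : Fin n, (x : ℕ) = t := ⟨⟨t, ht⟩, rfl⟩
      refine ⟨e1.eval (by decide) (by decide) (by decide) rfl,
        (Code.eval_reg (by decide) s').trans e2, ?_⟩
      have e4 : Encodes (s'.setReg 8 0) H W L := e1.congr rfl rfl rfl rfl
      have hbody : Code.scanBody.eval s' = if x ∈ W then
          (if H.Adj v x then ((((((s'.setReg 8 0).setReg 4 (v * n + x)).setReg 8 1).setReg 9
            (s'.reg 9 + 1)).setReg 11 (s'.reg 10)).setReg 10 x)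
          else (((s'.setReg 8 0).setReg 4 (v * n + x)).setReg 8 0)) else s'.setReg 8 1 := by
        have hload : (Instr.load 8 3 7).apply s' = s'.setReg 8 (if x ∈ W then 0 else 1) := by
          simp [Instr.apply, h7, e1.dead]
        rw [Code.scanBody, Code.eval_block_cons, Code.eval_instr, hload, Code.eval_block_cons,
          Code.eval_ite]
        by_cases hxW : x ∈ W
        · simp only [hxW, if_true]
          rw [if_pos (by simp [State.setReg]), Code.eval_block_cons,
            e4.getAdj_eval (i := v) (j := x) (by decide) (by simp [State.setReg, e2])
              (by simp [State.setReg, h7])]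
          by_cases hadj : H.Adj v x
          · simp [hadj, Code.eval_block_cons, Code.eval_block_nil, Code.eval_ite, Code.eval_instr,
              Instr.apply, State.setReg, h7, e1.one]
          · simp [hadj, Code.eval_block_cons, Code.eval_block_nil, Code.eval_ite, Code.eval_skip,
              State.setReg]
        · simp [hxW, Code.eval_block_nil, Code.eval_skip, State.setReg]
      rw [hbody]
      by_cases hx : x ∈ W ∧ H.Adj v x
      · have hN : (W.filter fun y => H.Adj v y ∧ (y : ℕ) < x + 1) =
            insert x (W.filter fun y => H.Adj v y ∧ (y : ℕ) < x) := by
          ext y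
          simp only [Finset.mem_filter, Finset.mem_insert, Nat.lt_succ_iff_lt_or_eq, Fin.val_inj]
          by_cases hy : y = x
          · simp [hy, hx]
          · simp [hy]
        rw [hN, if_pos hx.1, if_pos hx.2]
        simpa [State.setReg] using e3.insert (x := x) (by simp)
      · have hN : (W.filter fun y => H.Adj v y ∧ (y : ℕ) < x + 1) =
            W.filter fun y => H.Adj v y ∧ (y : ℕ) < x := by
          ext y
          simp only [Finset.mem_filter, Nat.lt_succ_iff_lt_or_eq, Fin.val_inj]
          by_cases hy : y = x
          · subst hy; simp; tauto
          · simp [hy]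
        rw [hN]
        by_cases hxW : x ∈ W
        · rw [if_pos hxW, if_neg (fun hadj => hx ⟨hxW, hadj⟩)]
          simpa [State.setReg] using e3
        · rw [if_neg hxW]
          simpa [State.setReg] using e3)
  rw [hs₁]
  have := key.2.2
  rw [h₁.size] at this
  simpa using this

theorem Encodes.merge (h : Encodes s H W L) {u w : Fin n} (hu : s.reg 10 = u) (hw : s.reg 11 = w)
    (huw : ¬ H.Adj u w) : Encodes (Code.merge.eval s) (H.mergeInto u w) W L := by
  classical
  have key := Code.eval_each_induction (i := 7) (B := Code.mergeBody) (s := s)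
    (I := fun t s' => s'.reg 1 = 1 ∧ s'.reg 10 = u ∧ s'.reg 11 = w ∧
      (∀ i : Fin n, s'.arr 2 i = i * n) ∧ ∀ i j : Fin n, s'.arr 0 (i * n + j) =
        if H.Adj i j ∨ (i = u ∧ H.Adj w j ∧ (j : ℕ) < t) ∨ (j = u ∧ H.Adj w i ∧ (i : ℕ) < t)
        then 1 else 0)
    (by simp [Code.Valid, Code.mergeBody, Code.block, Code.getAdj, Code.setAdj, Code.writes,
          Instr.target])
    h.one
    (by
      rintro t s' x v' hx ⟨e1, e2, e3, e4, e5⟩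
      have hne : 1 ≠ x ∧ 10 ≠ x ∧ 11 ≠ x := by omega
      obtain ⟨n1, n10, n11⟩ := hne
      refine ⟨?_, ?_, ?_, e4, e5⟩ <;> simp [State.setReg, *])
    ⟨h.one, hu, hw, h.row, by simpa using h.adj⟩
    (by
      rintro t ht s' - - h7 ⟨e1, e2, e3, e4, e5⟩
      rw [h.size] at ht
      obtain ⟨x, rfl⟩ : ∃ x : Fin n, (x : ℕ) = t := ⟨⟨t, ht⟩, rfl⟩
      refine ⟨(Code.eval_reg (by decide) s').trans e1, (Code.eval_reg (by decide) s').trans e2,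
        (Code.eval_reg (by decide) s').trans e3, ?_, ?_⟩
      · rw [Code.eval_arr (by decide)]
        exact e4
      have hwx : s'.arr 0 (w * n + x) = if H.Adj w x then 1 else 0 := by
        rw [e5]
        refine if_congr ?_ rfl rfl
        have := H.irrefl (v := w)
        grind
      have hget : (Code.getAdj 8 11 7).eval s' =
          (s'.setReg 4 (w * n + x)).setReg 8 (if H.Adj w x then 1 else 0) := by
        simp [Code.getAdj, Code.eval_block_cons, Code.eval_block_nil, Code.eval_instr,
          Instr.apply, State.setReg, e3, h7, e4, hwx]
      intro i j
      rw [Code.mergeBody, Code.eval_block_cons, hget, Code.eval_block_cons, Code.eval_block_nil,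
        Code.eval_ite]
      by_cases hadj : H.Adj w x
      · rw [if_neg (by simp [State.setReg, hadj]), Code.eval_block_cons,
          setAdj_eval (i := u) (j := x) (by simp [State.setReg, e1])
            (by simpa [State.setReg] using e4) (by decide) (by simp [State.setReg, e2])
            (by simp [State.setReg, h7]), Code.eval_block_cons,
          setAdj_eval (i := x) (j := u) (by simp [State.setReg, State.setArr, e1])
            (by simpa [State.setReg, State.setArr] using e4) (by decide)
            (by simp [State.setReg, State.setArr, h7])
            (by simp [State.setReg, State.setArr, e2]), Code.eval_block_nil]
        simp only [State.setReg, State.setArr, Function.update_self, Function.update_apply,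
          rowMajor_inj, e5]
        clear e5 e4 hget hwx h
        split_ifs <;> grind
      · rw [if_pos (by simp [State.setReg, hadj]), Code.eval_skip]
        simp only [State.setReg, e5]
        refine if_congr ?_ rfl rfl
        grind)
  rw [h.size] at key
  have hr : ∀ x, x ∉ Code.merge.writes → (Code.merge.eval s).reg x = s.reg x :=
    fun x hx => Code.eval_reg hx s
  have ha : ∀ a, a ∉ Code.merge.writesArr → (Code.merge.eval s).arr a = s.arr a :=
    fun a ha => Code.eval_arr ha s
  refine ⟨(hr 0 (by decide)).trans h.size, (hr 1 (by decide)).trans h.one, ?_, fun i j => ?_, ?_,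
    (hr 3 (by decide)).trans h.top, h.stack.congr ?_ ?_ ?_, ?_⟩
  · rw [ha 2 (by decide)]; exact h.row
  · rw [Code.merge, key.2.2.2.2 i j]
    refine if_congr ?_ rfl rfl
    rw [mergeInto_adj huw]
    simp
  · rw [ha 3 (by decide)]; exact h.dead
  · rw [ha 4 (by decide)]; exact fun _ _ => rfl
  · rw [ha 5 (by decide)]; exact fun _ _ => rfl
  · rw [ha 6 (by decide)]; exact fun _ _ => rfl
  · rw [ha 1 (by decide)]; exact h.out

end

end RAM

/-! ### Correctness of the program -/

namespace RAM

open SimpleGraph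

section

variable {n : ℕ} {s : State} {H : SimpleGraph (Fin n)} {W : Finset (Fin n)}
  {L : List (Fin n × Fin n × Fin n)}

/-- `u` and `w` cover all neighbours of `v` in `W`: the vertex `v` has degree at most two. -/
def HasCover (H : SimpleGraph (Fin n)) (W : Finset (Fin n)) (v : Fin n) : Prop :=
  ∃ x y, ∀ u ∈ W, H.Adj v u → u = x ∨ u = y

open Classical in
theorem IsScan.isNeighborPair {v : Fin n} {deg a b : ℕ}
    (h : IsScan v (W.filter (H.Adj v)) deg a b) (hv : v ∈ W) (hdeg : deg ≤ 2) :
    ∃ u w : Fin n, a = u ∧ b = w ∧ IsNeighborPair H W v u w := by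
  have hmem : ∀ x, x ∈ W.filter (H.Adj v) ↔ x ∈ W ∧ H.Adj v x := fun x => Finset.mem_filter
  generalize W.filter (H.Adj v) = N at h hmem
  have hc := h.deg_eq
  have hcases : N.card = 0 ∨ N.card = 1 ∨ N.card = 2 := by omega
  rcases hcases with h0 | h1 | h2
  · obtain ⟨ha, hb⟩ := h.zero h0
    refine ⟨v, v, ha, hb, hv, hv, hv, fun x hx hadj => ?_, Or.inl rfl, Or.inl rfl,
      fun _ => ⟨rfl, rfl⟩⟩
    have := (hmem x).2 ⟨hx, hadj⟩
    rw [Finset.card_eq_zero.1 h0] at this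
    simp at this
  · obtain ⟨u, hu, ha, hb⟩ := h.one h1
    have hu' := (hmem u).1 hu
    refine ⟨u, v, ha, hb, hv, hu'.1, hv, fun x hx hadj => Or.inl ?_, Or.inr hu'.2, Or.inl rfl,
      fun h => ?_⟩
    · exact Finset.card_le_one.1 h1.le x ((hmem x).2 ⟨hx, hadj⟩) u hu
    · have : u = v := by tauto
      exact ⟨this, rfl⟩
  · obtain ⟨u, hu, w, hw, huw, ha, hb⟩ := h.two h2
    have hu' := (hmem u).1 hu
    have hw' := (hmem w).1 hw
    refine ⟨u, w, ha, hb, hv, hu'.1, hw'.1, fun x hx hadj => ?_, Or.inr hu'.2, Or.inr hw'.2,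
      fun h => ?_⟩
    · have hN : {u, w} = N := Finset.eq_of_subset_of_card_le
        (by intro y hy; simp only [Finset.mem_insert, Finset.mem_singleton] at hy
            rcases hy with rfl | rfl <;> assumption)
        (by rw [h2, Finset.card_pair huw])
      have := (hmem x).2 ⟨hx, hadj⟩
      rw [← hN] at this
      simpa using this
    · rcases h with h | h
      · exact absurd h huw
      · exact absurd h hu'.2.ne'

open Classical in
theorem HasCover.card_le {v : Fin n} (h : HasCover H W v) : (W.filter (H.Adj v)).card ≤ 2 := by
  obtain ⟨x, y, hxy⟩ := h
  refine (Finset.card_le_card (t := {x, y}) fun u hu => ?_).trans Finset.card_le_two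
  rw [Finset.mem_filter] at hu
  simpa using hxy u hu.1 hu.2

/-- Passing from the first graph and stack to the second is justified: it preserves the invariant of
the reduction, and each new stack entry is paid for by a deleted vertex. -/
structure Leads (H : SimpleGraph (Fin n)) (W : Finset (Fin n)) (L : List (Fin n × Fin n × Fin n))
    (H' : SimpleGraph (Fin n)) (W' : Finset (Fin n)) (L' : List (Fin n × Fin n × Fin n)) :
    Prop where
  red : ∀ G, IsReduction G H W L → IsReduction G H' W' L'
  len : L'.length + W'.card ≤ L.length + W.card

theorem Encodes.visit (h : Encodes s H W L) {v : Fin n} (hv : s.reg 6 = v) :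
    ∃ H' W' L', Encodes (Code.visit.eval s) H' W' L' ∧ Leads H W L H' W' L' ∧
      (W' ⊂ W ∨ (H' = H ∧ W' = W ∧ (v ∈ W → ¬ HasCover H W v))) := by
  classical
  have hload : (Instr.load 8 3 6).apply s = s.setReg 8 (if v ∈ W then 0 else 1) := by
    simp [Instr.apply, hv, h.dead]
  have hleads : Leads H W L H W L := ⟨fun _ h => h, le_rfl⟩
  rw [Code.visit, Code.eval_block_cons, Code.eval_instr, hload, Code.eval_block_cons,
    Code.eval_block_nil, Code.eval_ite]
  by_cases hvW : v ∈ W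
  swap
  · rw [if_neg (by simp [State.setReg, hvW]), Code.eval_skip]
    exact ⟨H, W, L, h.congr rfl rfl rfl rfl, hleads, Or.inr ⟨rfl, rfl, fun h => absurd h hvW⟩⟩
  rw [if_pos (by simp [State.setReg, hvW]), Code.eval_block_cons]
  have h₁ : Encodes (s.setReg 8 (if v ∈ W then 0 else 1)) H W L := h.congr rfl rfl rfl rfl
  have h6 : (s.setReg 8 (if v ∈ W then 0 else 1)).reg 6 = v := hv
  have hscan := h₁.scan h6
  have h₂ := h₁.eval (C := Code.scan) (by decide) (by decide) (by decide) rfl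
  have h6' := (Code.eval_reg (C := Code.scan) (x := 6) (by decide) _).trans h6
  generalize Code.scan.eval (s.setReg 8 (if v ∈ W then 0 else 1)) = s₂ at hscan h₂ h6' ⊢
  have h₃ : Encodes (s₂.setReg 12 (3 - s₂.reg 9)) H W L := h₂.congr rfl rfl rfl rfl
  have htest : (Code.instr (.sub 12 12 9)).eval ((Code.instr (.const 12 3)).eval s₂) =
      s₂.setReg 12 (3 - s₂.reg 9) := by
    simp [Code.eval_instr, Instr.apply, State.setReg]
  rw [Code.eval_block_cons, Code.eval_block_cons, htest, Code.eval_block_cons, Code.eval_block_nil,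
    Code.eval_ite]
  by_cases hdeg : s₂.reg 9 ≤ 2
  swap
  · rw [if_pos (by simp [State.setReg]; omega), Code.eval_skip]
    refine ⟨H, W, L, h₃, hleads, Or.inr ⟨rfl, rfl, fun _ hcov => ?_⟩⟩
    have := hcov.card_le
    have := hscan.deg_eq
    omega
  rw [if_neg (by simp [State.setReg]; omega)]
  obtain ⟨u, w, hu, hw, hpair⟩ := hscan.isNeighborPair hvW hdeg
  have hlt : ∀ W' : Finset (Fin n), (∀ x, x ∈ W' ↔ x ∈ W ∧ x ≠ v ∧ x ∈ W') → W' ⊂ W := by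
    intro W' hW'
    refine (Finset.ssubset_iff_of_subset fun x hx => ((hW' x).1 hx).1).2 ⟨v, hvW, fun hv => ?_⟩
    exact ((hW' v).1 hv).2.1 rfl
  rw [Code.eval_block_cons, h₃.getAdj_eval (d := 8) (a := 10) (x := 11) (i := u) (j := w) (by decide) hu hw,
    Code.eval_block_cons, Code.eval_block_nil, Code.eval_ite]
  have h₄ : Encodes (((s₂.setReg 12 (3 - s₂.reg 9)).setReg 4 (u * n + w)).setReg 8
      (if H.Adj u w then 1 else 0)) H W L := h₃.congr rfl rfl rfl rfl
  have hv₄ : (((s₂.setReg 12 (3 - s₂.reg 9)).setReg 4 (u * n + w)).setReg 8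
      (if H.Adj u w then 1 else 0)).reg 6 = v := h6'
  have hu₄ : (((s₂.setReg 12 (3 - s₂.reg 9)).setReg 4 (u * n + w)).setReg 8
      (if H.Adj u w then 1 else 0)).reg 10 = u := hu
  have hw₄ : (((s₂.setReg 12 (3 - s₂.reg 9)).setReg 4 (u * n + w)).setReg 8
      (if H.Adj u w then 1 else 0)).reg 11 = w := hw
  have h8₄ : (((s₂.setReg 12 (3 - s₂.reg 9)).setReg 4 (u * n + w)).setReg 8
      (if H.Adj u w then 1 else 0)).reg 8 = if H.Adj u w then 1 else 0 := by simp [State.setReg]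
  generalize ((s₂.setReg 12 (3 - s₂.reg 9)).setReg 4 (u * n + w)).setReg 8
      (if H.Adj u w then 1 else 0) = s₄ at h₄ hv₄ hu₄ hw₄ h8₄ ⊢
  rw [h8₄]
  by_cases huw : H.Adj u w
  · rw [if_neg (by simp [huw])]
    simp only [Code.eval_block_cons, Code.eval_block_nil]
    have hW : ((W.erase v).erase u).erase w = W \ {v, u, w} := by
      ext x
      simp only [Finset.mem_erase, Finset.mem_sdiff, Finset.mem_insert, Finset.mem_singleton]
      tauto
    have hlt' := hlt (W \ {v, u, w}) (fun x => by
      simp only [Finset.mem_sdiff, Finset.mem_insert]; tauto)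
    have hcard := Finset.card_lt_card hlt'
    have h₅ := ((h₄.kill hv₄).kill (x := 10) hu₄).kill (x := 11) hw₄
    rw [hW] at h₅
    exact ⟨H, _, _, h₅.push (a := 6) (b := 6) (c := 6) hv₄ hv₄ hv₄,
      ⟨fun G hG => hG.select hpair huw, by simp only [List.length_cons]; omega⟩, Or.inl hlt'⟩
  · rw [if_pos (by simp [huw])]
    simp only [Code.eval_block_cons, Code.eval_block_nil]
    have hW : (W.erase v).erase w = W \ {v, w} := by
      ext x
      simp only [Finset.mem_erase, Finset.mem_sdiff, Finset.mem_insert, Finset.mem_singleton]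
      tauto
    have hlt' := hlt (W \ {v, w}) (fun x => by
      simp only [Finset.mem_sdiff, Finset.mem_insert]; tauto)
    have hcard := Finset.card_lt_card hlt'
    have h₅ := h₄.merge hu₄ hw₄ huw
    have hv₅ := (Code.eval_reg (C := Code.merge) (x := 6) (by decide) s₄).trans hv₄
    have hu₅ := (Code.eval_reg (C := Code.merge) (x := 10) (by decide) s₄).trans hu₄
    have hw₅ := (Code.eval_reg (C := Code.merge) (x := 11) (by decide) s₄).trans hw₄
    have h₆ := (h₅.kill hv₅).kill (x := 11) hw₅
    rw [hW] at h₆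
    exact ⟨_, _, _, h₆.push (a := 6) (b := 10) (c := 11) hv₅ hu₅ hw₅,
      ⟨fun G hG => hG.fold hpair huw, by simp only [List.length_cons]; omega⟩, Or.inl hlt'⟩

theorem valid_visit : (Code.each 6 Code.visit).Valid := by
  simp [Code.Valid, Code.visit, Code.scan, Code.scanBody, Code.merge, Code.mergeBody, Code.kill,
    Code.push, Code.block, Code.getAdj, Code.setAdj, Code.writes, Instr.target]

/-- A round deletes a vertex unless none is left, because some vertex has degree at most two. -/
theorem Encodes.round {G : SimpleGraph (Fin n)} (h : Encodes s H W L)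
    (hG : IsReduction G H W L) :
    ∃ H' W' L', Encodes ((Code.each 6 Code.visit).eval s) H' W' L' ∧ IsReduction G H' W' L' ∧
      L'.length + W'.card ≤ L.length + W.card ∧ W'.card ≤ W.card - 1 := by
  have key := Code.eval_each_induction (s := s)
    (I := fun t s' => ∃ H' W' L', Encodes s' H' W' L' ∧ Leads H W L H' W' L' ∧
      (W' ⊂ W ∨ (H' = H ∧ W' = W ∧ ∀ v : Fin n, (v : ℕ) < t → v ∈ W → ¬ HasCover H W v)))
    valid_visit h.one
    (by
      rintro t s' x v' hx ⟨H', W', L', e1, e2⟩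
      have hne : 0 ≠ x ∧ 1 ≠ x ∧ 3 ≠ x := by omega
      obtain ⟨n0, n1, n3⟩ := hne
      refine ⟨H', W', L', e1.congr ?_ ?_ ?_ rfl, e2⟩ <;> simp [State.setReg, *])
    ⟨H, W, L, h, ⟨fun _ h => h, le_rfl⟩, Or.inr ⟨rfl, rfl, by simp⟩⟩
    (by
      rintro t ht s' - - h6 ⟨H', W', L', e1, e2, e3⟩
      rw [h.size] at ht
      obtain ⟨v, rfl⟩ : ∃ v : Fin n, (v : ℕ) = t := ⟨⟨t, ht⟩, rfl⟩
      obtain ⟨H'', W'', L'', f1, f2, f3⟩ := e1.visit h6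
      refine ⟨H'', W'', L'', f1, ⟨fun G hG => f2.red G (e2.red G hG), f2.len.trans e2.len⟩, ?_⟩
      rcases e3 with e3 | ⟨rfl, rfl, e3⟩
      · left
        rcases f3 with f3 | ⟨-, rfl, -⟩
        · exact f3.trans e3
        · exact e3
      · rcases f3 with f3 | ⟨rfl, rfl, f3⟩
        · exact Or.inl f3
        · refine Or.inr ⟨rfl, rfl, fun x hx => ?_⟩
          rcases Nat.lt_succ_iff_lt_or_eq.1 hx with hx | hx
          · exact e3 x hx
          · rw [Fin.ext hx]
            exact f3)
  obtain ⟨H', W', L', e1, e2, e3⟩ := key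
  refine ⟨H', W', L', e1, e2.red G hG, e2.len, ?_⟩
  rcases e3 with e3 | ⟨rfl, rfl, e3⟩
  · have := Finset.card_lt_card e3
    omega
  · rcases W'.eq_empty_or_nonempty with rfl | hne
    · simp
    · obtain ⟨v, hv, x, y, hxy⟩ := exists_degree_le_two (W := (W' : Set (Fin n))) hne hG.noK4
      exact absurd ⟨x, y, hxy⟩ (e3 v (by rw [h.size]; exact v.2) hv)

theorem Encodes.reduce {G : SimpleGraph (Fin n)} (h : Encodes s G Finset.univ [])
    (hG : ¬ HasK4Model G Set.univ) :
    ∃ H L, Encodes (Code.reduce.eval s) H ∅ L ∧ IsReduction G H ∅ L ∧ L.length ≤ n := by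
  have key := Code.eval_each_induction (s := s) (i := 5) (B := Code.each 6 Code.visit)
    (I := fun t s' => ∃ H' W' L', Encodes s' H' W' L' ∧ IsReduction G H' W' L' ∧
      L'.length + W'.card ≤ n ∧ W'.card ≤ n - t)
    ⟨valid_visit, by decide, by omega⟩ h.one
    (by
      rintro t s' x v' hx ⟨H', W', L', e1, e2⟩
      have hne : 0 ≠ x ∧ 1 ≠ x ∧ 3 ≠ x := by omega
      obtain ⟨n0, n1, n3⟩ := hne
      refine ⟨H', W', L', e1.congr ?_ ?_ ?_ rfl, e2⟩ <;> simp [State.setReg, *])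
    ⟨G, Finset.univ, [], h, ⟨by simpa using hG, fun S hS => hS⟩, by simp, by simp⟩
    (by
      rintro t ht s' - - - ⟨H', W', L', e1, e2, e3, e4⟩
      obtain ⟨H'', W'', L'', f1, f2, f3, f4⟩ := e1.round e2
      exact ⟨H'', W'', L'', f1, f2, by omega, by omega⟩)
  obtain ⟨H', W', L', e1, e2, e3, e4⟩ := key
  rw [h.size, Nat.sub_self] at e4
  obtain rfl : W' = ∅ := Finset.card_eq_zero.1 (by omega)
  exact ⟨H', L', e1, e2, by omega⟩

theorem Encodes.unwindAll (h : Encodes s H W L) (hL : L.length ≤ n) :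
    Outputs (Code.unwindAll.eval s) (unwind L ∅) := by
  have key := Code.eval_each_induction (s := s) (i := 5) (B := Code.unwindBody)
    (I := fun t s' => s'.reg 1 = 1 ∧ s'.reg 3 = L.length ∧ StackOf s'.arr L ∧
      ∃ S : Finset (Fin n), Outputs s' S ∧ unwind (L.drop t) S = unwind L ∅)
    (by simp [Code.Valid, Code.unwindBody, Code.block, Code.writes, Instr.target]) h.one
    (by
      rintro t s' x v' hx ⟨e1, e2, e3⟩
      have hne : 1 ≠ x ∧ 3 ≠ x := by omega
      obtain ⟨n1, n3⟩ := hne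
      refine ⟨?_, ?_, e3⟩ <;> simp [State.setReg, *])
    ⟨h.one, h.top, h.stack, ∅, fun i => by simpa using h.out i, rfl⟩
    (by
      rintro t ht s' - - h5 ⟨e1, e2, e3, S, e4, e5⟩
      have harr : ∀ a, a ≠ 1 → (Code.unwindBody.eval s').arr a = s'.arr a := fun a ha =>
        Code.eval_arr (by simp [Code.unwindBody, Code.block, Code.writesArr, Instr.targetArr, ha]) s'
      refine ⟨(Code.eval_reg (by decide) s').trans e1, (Code.eval_reg (by decide) s').trans e2,
        e3.congr (by simp [harr]) (by simp [harr]) (by simp [harr]), ?_⟩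
      by_cases htL : t < L.length
      · have hdrop := List.drop_eq_getElem_cons htL
        generalize L[t] = x at hdrop
        obtain ⟨v, u, w⟩ := x
        have hst := e3.drop t
        rw [hdrop] at hst e5
        obtain ⟨h4, h5', h6, -⟩ := hst
        have hlen : (L.drop (t + 1)).length = L.length - t - 1 := by simp; omega
        rw [hlen] at h4 h5' h6
        have hne : L.length - t ≠ 0 := by omega
        refine ⟨if u ∈ S then insert w S else insert v S, ?_, e5⟩
        have hout : ∀ z : Fin n, Outputs (s'.setArr 1 z 1) (insert z S) := by
          intro z i
          have := e4 i
          simp only [State.setArr, Function.update_self, Function.update_apply, Fin.val_inj,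
            Finset.mem_insert, this]
          by_cases hiz : i = z <;> simp [hiz]
        by_cases huS : u ∈ S
        · rw [if_pos huS]
          suffices h : (Code.unwindBody.eval s').arr 1 = (s'.setArr 1 w 1).arr 1 from
            fun i => h ▸ hout w i
          simp [Code.unwindBody, Code.eval_block_cons, Code.eval_block_nil, Code.eval_ite,
            Code.eval_instr, Instr.apply, State.setReg, State.setArr, e1, e2, h5, hne, h4, h5', h6,
            e4 u, huS]
        · rw [if_neg huS]
          suffices h : (Code.unwindBody.eval s').arr 1 = (s'.setArr 1 v 1).arr 1 from
            fun i => h ▸ hout v i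
          simp [Code.unwindBody, Code.eval_block_cons, Code.eval_block_nil, Code.eval_ite,
            Code.eval_instr, Instr.apply, State.setReg, State.setArr, e1, e2, h5, hne, h4, h5', h6,
            e4 u, huS]
      · refine ⟨S, ?_, ?_⟩
        · have hz : L.length - t = 0 := by omega
          simpa [Outputs, Code.unwindBody, Code.eval_block_cons, Code.eval_block_nil,
            Code.eval_ite, Code.eval_instr, Code.eval_skip, Instr.apply, State.setReg, e2, h5, hz]
            using e4
        · rw [List.drop_eq_nil_of_le (by omega)] at e5 ⊢
          exact e5)
  rw [h.size] at key
  obtain ⟨-, -, -, S, h1, h2⟩ := key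
  rw [List.drop_eq_nil_of_le hL] at h2
  rw [← h2]
  exact h1

theorem Outputs.complement {S : Finset (Fin n)} (h0 : s.reg 0 = n) (h1 : s.reg 1 = 1)
    (h : Outputs s S) : Outputs (Code.complement.eval s) Sᶜ := by
  have key := Code.eval_each_induction (s := s) (i := 5)
    (B := Code.block [.instr (.load 8 1 5), .instr (.sub 8 1 8), .instr (.store 1 5 8)])
    (I := fun t s' => ∀ i : Fin n, s'.arr 1 i = if (i ∈ S ↔ (i : ℕ) < t) then 0 else 1)
    (by simp [Code.Valid, Code.block, Code.writes, Instr.target]) h1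
    (fun t s' x v' hx h => h) (by
      intro i
      rw [h i]
      by_cases hi : i ∈ S <;> simp [hi])
    (by
      rintro t ht s' - h1' h5 hI i
      rw [h0] at ht
      obtain ⟨x, rfl⟩ : ∃ x : Fin n, (x : ℕ) = t := ⟨⟨t, ht⟩, rfl⟩
      have hx := hI x
      have hi := hI i
      simp only [lt_self_iff_false, iff_false] at hx
      simp only [Code.eval_block_cons, Code.eval_block_nil, Code.eval_instr, Instr.apply,
        State.setReg, State.setArr, Function.update_apply, h5, h1', hx]
      by_cases hix : i = x
      · subst hix
        by_cases hiS : i ∈ S <;> simp [hiS]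
      · have : (i : ℕ) ≠ x := fun h => hix (Fin.ext h)
        have hlt : (i : ℕ) < x + 1 ↔ (i : ℕ) < x := by omega
        simp [this, hi, hlt])
  intro i
  rw [h0] at key
  rw [Code.complement, key i]
  by_cases hi : i ∈ S <;> simp [hi]

end

section

variable {n : ℕ}

theorem valid_maxIndep : Code.maxIndep.Valid := by
  refine ⟨?_, ⟨valid_visit, by decide, by omega⟩, ?_, trivial⟩ <;>
  simp [Code.Valid, Code.initRows, Code.unwindAll, Code.unwindBody, Code.block, Code.writes,
    Instr.target]

theorem encodes_initRows (G : SimpleGraph (Fin n)) :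
    Encodes (Code.initRows.eval ((Instr.const 1 1).apply (inputState G))) G Finset.univ [] := by
  classical
  have key := Code.eval_each_induction (s := (Instr.const 1 1).apply (inputState G)) (i := 7)
    (B := Code.block [.instr (.store 2 7 4), .instr (.add 4 4 0)])
    (I := fun t s' => s'.reg 4 = t * n ∧ ∀ i : Fin n, (i : ℕ) < t → s'.arr 2 i = i * n)
    (by simp [Code.Valid, Code.block, Code.writes, Instr.target])
    (by simp [Instr.apply, State.setReg])
    (by
      rintro t s' x v' hx ⟨e1, e2⟩
      have hne : 4 ≠ x := by omega
      exact ⟨by simp [State.setReg, hne, e1], e2⟩)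
    ⟨by simp [Instr.apply, State.setReg, inputState], by simp⟩
    (by
      rintro t ht s' h0 - h7 ⟨e1, e2⟩
      have h0' : s'.reg 0 = n := by rw [h0]; simp [Instr.apply, State.setReg, inputState]
      refine ⟨?_, fun i hi => ?_⟩
      · simp [Code.eval_block_cons, Code.eval_block_nil, Code.eval_instr, Instr.apply,
          State.setReg, State.setArr, e1, h0', Nat.add_mul]
      · by_cases hit : (i : ℕ) = t
        · simp [Code.eval_block_cons, Code.eval_block_nil, Code.eval_instr, Instr.apply,
            State.setReg, State.setArr, e1, h7, hit]
        · simpa [Code.eval_block_cons, Code.eval_block_nil, Code.eval_instr, Instr.apply,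
            State.setReg, State.setArr, h7, hit] using e2 i (by omega))
  have hr : ∀ x, x ∉ Code.initRows.writes → (Code.initRows.eval ((Instr.const 1 1).apply
      (inputState G))).reg x = ((Instr.const 1 1).apply (inputState G)).reg x :=
    fun x hx => Code.eval_reg hx _
  have ha : ∀ a, a ∉ Code.initRows.writesArr → (Code.initRows.eval ((Instr.const 1 1).apply
      (inputState G))).arr a = (inputState G).arr a :=
    fun a ha => Code.eval_arr ha _
  have hsize : ((Instr.const 1 1).apply (inputState G)).reg 0 = n := by
    simp [Instr.apply, State.setReg, inputState]
  rw [hsize] at key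
  refine ⟨(hr 0 (by decide)).trans hsize, (hr 1 (by decide)).trans ?_, fun i => key.2 i i.2,
    fun i j => ?_, fun i => ?_, (hr 3 (by decide)).trans ?_, trivial, fun i => ?_⟩
  · simp [Instr.apply, State.setReg]
  · rw [ha 0 (by decide)]
    refine if_congr ⟨?_, fun h => ⟨rfl, i, j, rfl, h⟩⟩ rfl rfl
    rintro ⟨-, i', j', h, hadj⟩
    obtain ⟨rfl, rfl⟩ := rowMajor_inj.1 h
    exact hadj
  · rw [ha 3 (by decide)]
    simp [inputState]
  · simp [Instr.apply, State.setReg, inputState]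
  · rw [ha 1 (by decide)]
    simp [inputState]

/-- The program `maxIndep` outputs a maximum independent set of every graph without the minor. -/
theorem outputs_maxIndep {G : SimpleGraph (Fin n)} (hG : ¬ HasK4Model G Set.univ) :
    ∃ S : Finset (Fin n),
      Outputs (Code.maxIndep.eval ((Instr.const 1 1).apply (inputState G))) S ∧
      G.IsMaximumIndepSet S := by
  obtain ⟨H, L, h1, h2, h3⟩ := (encodes_initRows G).reduce hG
  refine ⟨unwind L ∅, h1.unwindAll h3, ?_⟩
  have hmax := h2.unwind ∅ ⟨subset_rfl, by simp, fun T hT _ => Finset.card_le_card hT⟩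
  exact ⟨isIndepSet_iff_forall_not_adj.2 hmax.indep,
    fun T hT => hmax.max T (Finset.subset_univ T) (isIndepSet_iff_forall_not_adj.1 hT)⟩

/-- Running compiled code from the input state after setting up the constant register. -/
theorem exec_input {C : Code} (hC : C.Valid) (G : SimpleGraph (Fin n)) :
    ∃ t ≤ (1 + C.time).eval n, Exec (.seq (.instr (.const 1 1)) C.compile) (inputState G) t
      (C.eval ((Instr.const 1 1).apply (inputState G))) := by
  obtain ⟨t, ht, h⟩ := Code.exec_compile hC (s := (Instr.const 1 1).apply (inputState G))
    (by simp [Instr.apply, State.setReg])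
  have hsize : ((Instr.const 1 1).apply (inputState G)).reg 0 = n := by
    simp [Instr.apply, State.setReg, inputState]
  rw [hsize] at ht
  exact ⟨1 + t, by simpa using ht, (Exec.instr _ _).seq h⟩

theorem isMinimumVertexCover_compl {G : SimpleGraph (Fin n)} {S : Finset (Fin n)}
    (h : G.IsMaximumIndepSet S) : IsMinimumVertexCover G Sᶜ := by
  refine ⟨?_, fun T hT => ?_⟩
  · rw [Finset.coe_compl]
    exact isVertexCover_compl.2 h.isIndepSet
  · have h1 := h.maximum Tᶜ (by
      rw [Finset.coe_compl]; exact isIndepSet_compl_iff_isVertexCover.2 hT)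
    rw [Finset.card_compl] at h1 ⊢
    omega

end

end RAM

theorem mainTheorem1 :
    RAM.PolyTimeSolvable
      (fun _ G => ∃ k : ℕ, 5 ≤ k ∧ IsStrictlyChordality k G)
      (fun _ G S => G.IsMaximumIndepSet S) ∧
    RAM.PolyTimeSolvable
      (fun _ G => ∃ k : ℕ, 5 ≤ k ∧ IsStrictlyChordality k G)
      (fun _ G S => IsMinimumVertexCover G S) := by
  have hK : ∀ (n : ℕ) (G : SimpleGraph (Fin n)), (∃ k : ℕ, 5 ≤ k ∧ IsStrictlyChordality k G) →
      ¬ SimpleGraph.HasK4Model G Set.univ := by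
    rintro n G ⟨k, hk, h⟩
    exact SimpleGraph.not_hasK4Model hk
      (fun m hm => h.elim (fun h => absurd hm (h m)) fun h => h m hm) _
  refine ⟨⟨.seq (.instr (.const 1 1)) RAM.Code.maxIndep.compile, 1 + RAM.Code.maxIndep.time,
    fun n G hG => ?_⟩, ⟨.seq (.instr (.const 1 1)) (RAM.Code.seq RAM.Code.maxIndep
      RAM.Code.complement).compile, 1 + (RAM.Code.seq RAM.Code.maxIndep RAM.Code.complement).time,
    fun n G hG => ?_⟩⟩
  · obtain ⟨t, ht, hexec⟩ := RAM.exec_input RAM.valid_maxIndep G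
    obtain ⟨S, hS, hmax⟩ := RAM.outputs_maxIndep (hK n G hG)
    exact ⟨t, _, S, hexec, ht, hS, hmax⟩
  · have hvalid : (RAM.Code.seq RAM.Code.maxIndep RAM.Code.complement).Valid :=
      ⟨RAM.valid_maxIndep, by
        simp [RAM.Code.Valid, RAM.Code.complement, RAM.Code.block, RAM.Code.writes,
          RAM.Instr.target]⟩
    obtain ⟨t, ht, hexec⟩ := RAM.exec_input hvalid G
    obtain ⟨S, hS, hmax⟩ := RAM.outputs_maxIndep (hK n G hG)
    refine ⟨t, _, Sᶜ, hexec, ht, hS.complement ?_ ?_, RAM.isMinimumVertexCover_compl hmax⟩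
    · rw [RAM.Code.eval_reg RAM.valid_maxIndep.reserved.1]
      simp [RAM.Instr.apply, RAM.State.setReg, RAM.inputState]
    · rw [RAM.Code.eval_reg RAM.valid_maxIndep.reserved.2]
      simp [RAM.Instr.apply, RAM.State.setReg]
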